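/- Let $\Lambda\subset\mathbb R^2$ be the lattice generated by $\mathbf v_0=(1,0)$, $\mathbf v_1=(-\frac12,\frac{\sqrt3}2)$ and $\mathbf v_2=(-\frac12,-\frac{\sqrt3}2)$. Consider the trihexagonal tiling of the plane, by regular hexagons of side length one with centers at the points of $2\Lambda$ and corners at the points $\mathbf c\pm\mathbf v_i$ ($\mathbf c\in 2\Lambda$, $i=0,1,2$), and by the equilateral triangles of side length one that fill the gaps between them. Let $X=\mathbb R^2\times S^1$ be the unit tangent bundle of the plane. The refractive flow $T$ on $X$ moves a unit tangent vector straight ahead at unit speed inside each tile. When the base point crosses an edge at an interior point of the edge, the direction is refracted with refraction coefficient $-1$: the component of the direction along the edge changes sign and the component normal to the edge is kept. (At the moment of the crossing we take the direction after the refraction.) A trajectory $t\mapsto T^t(x)$ is not continued through the vertices of the tiling; it is periodic if it is defined for all $t\in\mathbb R$ and if there is $\tau>0$ with $T^{t+\tau}(x)=T^t(x)$ for all $t$. Let $\gamma=\{T^t(x):t\in\mathbb R\}\subset X$ be a periodic trajectory. Then: 1. There is a rotation of order three of the plane that maps the tiling to itself and maps $\gamma$ onto itself (as a set of unit tangent vectors,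 hence also as a path in the plane). 2. No rotation of order six of the plane that maps the tiling to itself maps $\gamma$ onto itself, neither as a set of unit tangent vectors nor as a path in the plane. -/

import Mathlib

open Set Filter Topology

noncomputable section

namespace Trihexagonal

/- The Euclidean plane is the complex plane. -/

/-- The vector `(1, 0)`. -/
def v₀ : ℂ := 1

/-- The vector `(-1/2, √3/2)`. -/
def v₁ : ℂ := ⟨-1 / 2, √3 / 2⟩

/-- The vector `(-1/2, -√3/2)`. -/
def v₂ : ℂ := ⟨-1 / 2, -(√3 / 2)⟩

/-- The Eisenstein lattice `Λ`. -/
def eisensteinLattice : AddSubgroup ℂ := AddSubgroup.closure {v₀, v₁, v₂}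

/-- The six corners of the regular hexagon with centre `c` and side length one. -/
def hexagonVertices (c : ℂ) : Set ℂ :=
  {c + v₀, c + v₁, c + v₂, c - v₀, c - v₁, c - v₂}

/-- The vertices of the trihexagonal tiling whose hexagons are centred at the points of `2Λ`. -/
def vertices : Set ℂ := {p | ∃ c ∈ eisensteinLattice, p ∈ hexagonVertices (2 * c)}

/-- `a` and `b` are the endpoints of an edge: all edges have length one, and vertices at distance
one are joined by an edge. -/
def IsEdge (a b : ℂ) : Prop := a ∈ vertices ∧ b ∈ vertices ∧ dist a b = 1

/-- The hexagonal tiles. -/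
def hexagons : Set (Set ℂ) :=
  {P | ∃ c ∈ eisensteinLattice, P = convexHull ℝ (hexagonVertices (2 * c))}

/-- The triangular tiles: any three vertices, pairwise joined by edges, span one of them. -/
def triangles : Set (Set ℂ) :=
  {P | ∃ a b c, IsEdge a b ∧ IsEdge b c ∧ IsEdge c a ∧ P = convexHull ℝ {a, b, c}}

/-- The tiles of the trihexagonal tiling. -/
def tiles : Set (Set ℂ) := hexagons ∪ triangles

/-- A map of the plane permutes the tiles. It is used for isometries only. -/
def PreservesTiling (f : ℂ → ℂ) : Prop := (fun P => f '' P) '' tiles = tiles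

/-- The rotation of the plane about `c` whose linear part is multiplication by `ω`, `|ω| = 1`.
Its order is the order of `ω` in the circle group. -/
def rotation (c : ℂ) (ω : Circle) (z : ℂ) : ℂ := c + ω * (z - c)

/-- `X`: the unit tangent bundle of the plane, (base point, direction). -/
abbrev UnitTangentBundle : Type := ℂ × Circle

/-- The action of the rotation `rotation c ω` on unit tangent vectors, by its derivative. -/
def rotationOnTangent (c : ℂ) (ω : Circle) (x : UnitTangentBundle) : UnitTangentBundle :=
  (rotation c ω x.1, ω * x.2)

/-- Refraction with coefficient `-1` across a line with direction vector `e`: the component of `d`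
along the line changes sign, the normal component is kept. So a ray making the angle `θ` with the
normal continues on the other side of the line at the angle `-θ`; the lines carrying the two rays
are mirror images of each other in the line with direction `e`. -/
def refract (e d : ℂ) : ℂ := -(Submodule.reflection (Submodule.span ℝ {e}) d)

/-- The straight motion at unit speed that is at the base point of `x` at time `t`, in the
direction of `x`. -/
def straight (x : UnitTangentBundle) (t s : ℝ) : UnitTangentBundle :=
  (x.1 + (s - t) • (x.2 : ℂ), x.2)

/-- `x` is a non-singular trajectory `t ↦ T^t (x 0)`, defined for all times, of the refractive flow
`T` on the trihexagonal tiling: the base point never is at a vertex, it moves straight at unit speed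
inside each tile, and it is refracted at each edge that it meets. At the moment of the crossing,
the direction is the one after the refraction. (The refraction rule cannot hold throughout a motion
along an edge. Such a motion would run into a vertex, so it belongs to no non-singular
trajectory.) -/
structure IsTrajectory (x : ℝ → UnitTangentBundle) : Prop where
  notMem_vertices : ∀ t, (x t).1 ∉ vertices
  interior_tile : ∀ t, ∀ P ∈ tiles, (x t).1 ∈ interior P → ∀ᶠ s in 𝓝 t, x s = straight (x t) t s
  edge : ∀ t a b, IsEdge a b → (x t).1 ∈ openSegment ℝ a b →
    (∀ᶠ s in 𝓝[≥] t, x s = straight (x t) t s) ∧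
      ∃ d : Circle, ((x t).2 : ℂ) = refract (b - a) d ∧
        ∀ᶠ s in 𝓝[<] t, x s = straight ((x t).1, d) t s

/-- A periodic trajectory of the refractive flow. -/
def IsPeriodicTrajectory (x : ℝ → UnitTangentBundle) : Prop :=
  IsTrajectory x ∧ ∃ τ : ℝ, 0 < τ ∧ Function.Periodic x τ

/-- The orbit of a trajectory, as a set of unit tangent vectors. -/
def orbit (x : ℝ → UnitTangentBundle) : Set UnitTangentBundle := range x

/-- The path in the plane that is traced by a trajectory. -/
def path (x : ℝ → UnitTangentBundle) : Set ℂ := range fun t => (x t).1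

end Trihexagonal

end

/-!
The plane has coordinates `z = X + Y ζ` with `ζ = exp (π i / 3)`, and directions are recorded by
the triple `(X, Y, -X - Y)`. In these coordinates the lattice is `ℤ²`, the edges lie on the lines
on which `X`, `Y` or `X + Y` is an odd integer, and the refraction at such a line exchanges two
entries of the triple. So in passing from a hexagon through a triangle to the next hexagon, the
direction is turned by the cube root of unity `ω = ζ²` or its inverse.

A passage through a hexagon is described by the centre of the hexagon, by the direction `u`, and
by the `offset`, the signed distance of the oriented line from the centre. The sign of the offset
never changes, and a reflection of the plane makes it positive. Up to a symmetry, `Y u ≤ 0 < X u +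
Y u`. With `a = X u` and `b = -Y u`, a computation (`IsTrajectory.next_passage_lower`,
`IsTrajectory.next_passage_upper`) shows that the trajectory turns around a corner of the hexagon,
that `u` becomes `ω u`, and that the offset `p ∈ (0, a)` becomes `p - b` or `p - b + a`. Thus the
offsets form an orbit of a rotation of the circle `ℝ / aℤ`, and since `p` also determines the
corner, the first passage determines all later ones (`IsTrajectory.exists_passages`).

If `n` is a number of passages after which the offset recurs, then the symmetry `g` of the tiling
that takes the first passage to the `n`-th one has the linear part `ω ^ n`, and it maps the
trajectory onto itself, because the flow is deterministic (`image_orbit_eq`). If three does not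
divide `n`, then `g` is a rotation of order three. It remains to find such an `n`. Periodicity
gives a number `N > 0` of passages after which the offset and the hexagon recur. If `3 ∣ N`, then
the vanishing displacement is a nonzero multiple of `∑ χ i * ω ^ i`, `i < N`, where `χ i` is one
if the rotation of the offsets passes through zero in the step `i`, and is zero otherwise.
Reduction modulo the prime above three shows that three divides `∑ χ i`, the number of turns of
the rotation in `N` steps. Hence the offset recurs after `N / 3` passages already, and a descent
gives `n` (`exists_not_three_dvd`).

There is no symmetry of order six because all passages have positive offsets. A rotation of order
six is multiplication by `-ω ^ j` about the centre of a hexagon. If it maps the path onto itself,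
then the image of a segment of the path in a hexagon has to be covered by passages through the
image hexagon. One of these is collinear with it, since countably many lines that cross a segment
do not cover it. Its direction is opposite to that of the image of the segment, so it has a
negative offset (`not_image_path_eq`).
-/

open Set Filter Topology

noncomputable section

namespace Trihexagonal

/-! ### Symmetries of the tiling -/

/-- An affine isometry of the plane that permutes the vertices and the hexagons of the tiling. -/
structure IsTilingSymmetry (f : ℂ ≃ᵃⁱ[ℝ] ℂ) : Prop where
  image_vertices : f '' vertices = vertices
  image_hexagons : (fun P : Set ℂ => f '' P) '' hexagons = hexagons

/-- The action of an affine isometry on unit tangent vectors, by its derivative. -/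
def tangentMap (f : ℂ ≃ᵃⁱ[ℝ] ℂ) (x : UnitTangentBundle) : UnitTangentBundle :=
  (f x.1, ⟨f.linearIsometryEquiv x.2, by simp [Submonoid.unitSphere, Circle.norm_coe]⟩)

@[simp] theorem tangentMap_fst (f : ℂ ≃ᵃⁱ[ℝ] ℂ) (x : UnitTangentBundle) :
    (tangentMap f x).1 = f x.1 := rfl

@[simp] theorem coe_tangentMap_snd (f : ℂ ≃ᵃⁱ[ℝ] ℂ) (x : UnitTangentBundle) :
    ((tangentMap f x).2 : ℂ) = f.linearIsometryEquiv x.2 := rfl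

theorem tangentMap_symm_apply (f : ℂ ≃ᵃⁱ[ℝ] ℂ) (x : UnitTangentBundle) :
    tangentMap f.symm (tangentMap f x) = x := by
  ext
  · simp
  · exact f.linearIsometryEquiv.symm_apply_apply _

theorem tangentMap_apply_symm (f : ℂ ≃ᵃⁱ[ℝ] ℂ) (x : UnitTangentBundle) :
    tangentMap f (tangentMap f.symm x) = x := by
  ext
  · simp
  · exact f.linearIsometryEquiv.apply_symm_apply _

theorem apply_add_smul (f : ℂ ≃ᵃⁱ[ℝ] ℂ) (z u : ℂ) (r : ℝ) :
    f (z + r • u) = f z + r • f.linearIsometryEquiv u := by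
  have := f.map_vadd z (r • u)
  rw [map_smul] at this
  simpa only [vadd_eq_add, add_comm] using this

theorem tangentMap_straight (f : ℂ ≃ᵃⁱ[ℝ] ℂ) (x : UnitTangentBundle) (t s : ℝ) :
    tangentMap f (straight x t s) = straight (tangentMap f x) t s := by
  ext
  · simp only [straight, tangentMap_fst, coe_tangentMap_snd, apply_add_smul]
  · simp [straight]

theorem linear_sub (f : ℂ ≃ᵃⁱ[ℝ] ℂ) (a b : ℂ) :
    f.linearIsometryEquiv (b - a) = f b - f a := by
  have := f.toAffineEquiv.toAffineMap.linearMap_vsub b a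
  simpa using this

theorem refract_map (L : ℂ ≃ₗᵢ[ℝ] ℂ) (e d : ℂ) : refract (L e) (L d) = L (refract e d) := by
  have h : Submodule.span ℝ {L e} = (Submodule.span ℝ {e}).map (L.toLinearEquiv : ℂ →ₗ[ℝ] ℂ) := by
    rw [Submodule.map_span]; simp
  have h2 := Submodule.reflection_map_apply L (Submodule.span ℝ {e}) (L d)
  simp only [refract, map_neg]
  congr 1
  rw [LinearIsometryEquiv.symm_apply_apply] at h2
  rw [← h2]
  congr 1
  simp only [h]

theorem image_convexHull_isometry (f : ℂ ≃ᵃⁱ[ℝ] ℂ) (s : Set ℂ) :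
    f '' convexHull ℝ s = convexHull ℝ (f '' s) :=
  f.toAffineEquiv.toAffineMap.image_convexHull s

namespace IsTilingSymmetry

variable {f g : ℂ ≃ᵃⁱ[ℝ] ℂ}

theorem symm (hf : IsTilingSymmetry f) : IsTilingSymmetry f.symm where
  image_vertices := by
    conv_lhs => rw [← hf.image_vertices, ← image_comp]
    simp
  image_hexagons := by
    conv_lhs => rw [← hf.image_hexagons, ← image_comp]
    simp [← image_comp]

theorem trans (hf : IsTilingSymmetry f) (hg : IsTilingSymmetry g) :
    IsTilingSymmetry (f.trans g) where
  image_vertices := by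
    rw [AffineIsometryEquiv.coe_trans, image_comp, hf.image_vertices, hg.image_vertices]
  image_hexagons := by
    have : (fun P : Set ℂ => (f.trans g) '' P) = (fun P => g '' P) ∘ (fun P => f '' P) := by
      funext P
      rw [AffineIsometryEquiv.coe_trans, image_comp]; rfl
    rw [this, image_comp, hf.image_hexagons, hg.image_hexagons]

theorem mem_vertices (hf : IsTilingSymmetry f) {p : ℂ} (hp : p ∈ vertices) : f p ∈ vertices :=
  hf.image_vertices ▸ mem_image_of_mem f hp

theorem isEdge (hf : IsTilingSymmetry f) {a b : ℂ} (h : IsEdge a b) : IsEdge (f a) (f b) :=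
  ⟨hf.mem_vertices h.1, hf.mem_vertices h.2.1, by rw [f.dist_map, h.2.2]⟩

theorem mem_tiles (hf : IsTilingSymmetry f) {P : Set ℂ} (hP : P ∈ tiles) : f '' P ∈ tiles := by
  rcases hP with hP | ⟨a, b, c, hab, hbc, hca, rfl⟩
  · exact Or.inl (hf.image_hexagons ▸ mem_image_of_mem _ hP)
  · refine Or.inr ⟨f a, f b, f c, hf.isEdge hab, hf.isEdge hbc, hf.isEdge hca, ?_⟩
    rw [image_convexHull_isometry, image_insert_eq, image_pair]

theorem preservesTiling (hf : IsTilingSymmetry f) : PreservesTiling f := by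
  refine Subset.antisymm ?_ fun P hP => ?_
  · rintro _ ⟨P, hP, rfl⟩
    exact hf.mem_tiles hP
  · refine ⟨f.symm '' P, hf.symm.mem_tiles hP, ?_⟩
    simp [← image_comp]

/-- Symmetries of the tiling map trajectories to trajectories. -/
theorem isTrajectory (hf : IsTilingSymmetry f) {x : ℝ → UnitTangentBundle}
    (hx : IsTrajectory x) : IsTrajectory fun t => tangentMap f (x t) where
  notMem_vertices t ht := hx.notMem_vertices t <| by
    simpa using hf.symm.mem_vertices ht
  interior_tile t P hP ht := by
    have h1 : (x t).1 ∈ interior (f.symm '' P) := by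
      have := mem_image_of_mem f.symm ht
      have h2 := f.symm.toHomeomorph.image_interior P
      simp only [AffineIsometryEquiv.coe_toHomeomorph] at h2
      rw [h2] at this
      simpa using this
    filter_upwards [hx.interior_tile t _ (hf.symm.mem_tiles hP) h1] with s hs
    rw [hs, tangentMap_straight]
  edge t a b hab ht := by
    have h1 : (x t).1 ∈ openSegment ℝ (f.symm a) (f.symm b) := by
      have := mem_image_of_mem f.symm ht
      have h2 := image_openSegment ℝ f.symm.toAffineEquiv.toAffineMap a b
      simp only [tangentMap_fst] at this
      rw [AffineIsometryEquiv.symm_apply_apply] at this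
      exact h2 ▸ this
    obtain ⟨h2, d, hd, h3⟩ := hx.edge t _ _ (hf.symm.isEdge hab) h1
    refine ⟨?_, (tangentMap f (0, d)).2, ?_, ?_⟩
    · filter_upwards [h2] with s hs
      rw [hs, tangentMap_straight]
    · rw [coe_tangentMap_snd, hd, coe_tangentMap_snd, ← refract_map, linear_sub]
      simp
    · filter_upwards [h3] with s hs
      rw [hs, tangentMap_straight]
      rfl

end IsTilingSymmetry

theorem mem_hexagonVertices_iff {c p : ℂ} : p ∈ hexagonVertices c ↔ p - c ∈ hexagonVertices 0 := by
  simp only [hexagonVertices, mem_insert_iff, mem_singleton_iff, zero_add, zero_sub,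
    sub_eq_iff_eq_add']
  simp only [sub_eq_add_neg]

theorem mem_lattice_of_mem_hexagonVertices {v : ℂ} (hv : v ∈ hexagonVertices 0) :
    v ∈ eisensteinLattice := by
  have h : ∀ w ∈ ({v₀, v₁, v₂} : Set ℂ), w ∈ eisensteinLattice :=
    fun w hw => AddSubgroup.subset_closure hw
  simp only [hexagonVertices, mem_insert_iff, mem_singleton_iff, zero_add, zero_sub] at hv
  rcases hv with rfl | rfl | rfl | rfl | rfl | rfl
  exacts [h _ (by simp), h _ (by simp), h _ (by simp), neg_mem (h _ (by simp)),
    neg_mem (h _ (by simp)), neg_mem (h _ (by simp))]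

/-- The isometry `z ↦ L z + d`. -/
def isometryOf (L : ℂ ≃ₗᵢ[ℝ] ℂ) (d : ℂ) : ℂ ≃ᵃⁱ[ℝ] ℂ :=
  L.toAffineIsometryEquiv.trans (AffineIsometryEquiv.constVAdd ℝ ℂ d)

@[simp] theorem isometryOf_apply (L : ℂ ≃ₗᵢ[ℝ] ℂ) (d z : ℂ) : isometryOf L d z = d + L z := rfl

@[simp] theorem isometryOf_linear (L : ℂ ≃ₗᵢ[ℝ] ℂ) (d : ℂ) :
    (isometryOf L d).linearIsometryEquiv = L := by
  ext z
  have := linear_sub (isometryOf L d) 0 z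
  simpa using this

theorem isometryOf_symm_apply (L : ℂ ≃ₗᵢ[ℝ] ℂ) (d z : ℂ) :
    (isometryOf L d).symm z = L.symm (z - d) := by
  apply (isometryOf L d).injective
  simp

/-- An isometry `z ↦ L z + 2λ` is a symmetry of the tiling if `λ` is in the lattice and `L`
permutes the six unit vectors of the lattice. -/
theorem isTilingSymmetry_isometryOf {L : ℂ ≃ₗᵢ[ℝ] ℂ}
    (hL : ∀ v ∈ hexagonVertices 0, L v ∈ hexagonVertices 0)
    (hL' : ∀ v ∈ hexagonVertices 0, L.symm v ∈ hexagonVertices 0)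
    {l : ℂ} (hl : l ∈ eisensteinLattice) : IsTilingSymmetry (isometryOf L (2 * l)) := by
  have key : ∀ M : ℂ ≃ₗᵢ[ℝ] ℂ, (∀ v ∈ hexagonVertices 0, M v ∈ hexagonVertices 0) →
      ∀ c ∈ eisensteinLattice, M c ∈ eisensteinLattice := by
    intro M hM c hc
    induction hc using AddSubgroup.closure_induction with
    | mem v hv =>
      refine mem_lattice_of_mem_hexagonVertices (hM v ?_)
      simp only [mem_insert_iff, mem_singleton_iff] at hv
      rcases hv with rfl | rfl | rfl <;> simp [hexagonVertices]
    | zero => simp [zero_mem]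
    | add a b _ _ ha hb => rw [map_add]; exact add_mem ha hb
    | neg a _ ha => rw [map_neg]; exact neg_mem ha
  set f := isometryOf L (2 * l) with hf
  have two : ∀ (M : ℂ ≃ₗᵢ[ℝ] ℂ) (a : ℂ), M (2 * a) = 2 * M a := fun M a => by
    rw [two_mul, map_add, ← two_mul]
  have h1 : ∀ c, f '' hexagonVertices (2 * c) = hexagonVertices (2 * (l + L c)) := by
    intro c
    ext p
    rw [mem_hexagonVertices_iff]
    constructor
    · rintro ⟨q, hq, rfl⟩
      rw [mem_hexagonVertices_iff] at hq
      have := hL _ hq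
      rw [map_sub, two] at this
      convert this using 1
      simp only [hf, isometryOf_apply]; ring
    · intro hp
      refine ⟨f.symm p, ?_, by simp⟩
      rw [mem_hexagonVertices_iff]
      convert hL' _ hp using 1
      rw [hf, isometryOf_symm_apply]
      rw [map_sub, map_sub, two, two, map_add, LinearIsometryEquiv.symm_apply_apply]; ring
  have h2 : ∀ c ∈ eisensteinLattice, ∃ c' ∈ eisensteinLattice, l + L c' = c := fun c hc =>
    ⟨L.symm (c - l), key L.symm hL' _ (sub_mem hc hl), by simp⟩
  have h3 : ∀ c ∈ eisensteinLattice, l + L c ∈ eisensteinLattice := fun c hc =>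
    add_mem hl (key L hL _ hc)
  constructor
  · ext p
    constructor
    · rintro ⟨q, ⟨c, hc, hq⟩, rfl⟩
      exact ⟨_, h3 c hc, h1 c ▸ mem_image_of_mem f hq⟩
    · rintro ⟨c, hc, hp⟩
      obtain ⟨c', hc', rfl⟩ := h2 c hc
      rw [← h1] at hp
      obtain ⟨q, hq, rfl⟩ := hp
      exact mem_image_of_mem f ⟨c', hc', hq⟩
  · ext P
    constructor
    · rintro ⟨_, ⟨c, hc, rfl⟩, rfl⟩
      exact ⟨_, h3 c hc, by simp only [image_convexHull_isometry, h1]⟩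
    · rintro ⟨c, hc, rfl⟩
      obtain ⟨c', hc', rfl⟩ := h2 c hc
      exact ⟨_, ⟨c', hc', rfl⟩, by simp only [image_convexHull_isometry, h1]⟩

/-! ### Lattice coordinates -/

/-- The first coordinate with respect to the basis `1`, `exp (π i / 3)` of the plane. -/
def xCoord : ℂ →ₗ[ℝ] ℝ := Complex.reLm - (1 / √3) • Complex.imLm

/-- The second coordinate with respect to the basis `1`, `exp (π i / 3)` of the plane. -/
def yCoord : ℂ →ₗ[ℝ] ℝ := (2 / √3) • Complex.imLm

/-- The primitive sixth root of unity `exp (π i / 3)`. -/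
def zeta : Circle := ⟨⟨1 / 2, √3 / 2⟩, by
  have h : √3 * √3 = 3 := Real.mul_self_sqrt (by norm_num)
  simp only [Submonoid.unitSphere, Submonoid.mem_mk, Subsemigroup.mem_mk, mem_sphere_iff_norm,
    sub_zero, Complex.norm_def, Complex.normSq_mk, Real.sqrt_eq_one]
  linarith⟩

/-- The point with coordinates `a`, `b`. -/
def pt (a b : ℝ) : ℂ := a + b * zeta

theorem xCoord_apply (z : ℂ) : xCoord z = z.re - z.im / √3 := by
  simp [xCoord]; ring

theorem yCoord_apply (z : ℂ) : yCoord z = 2 * z.im / √3 := by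
  simp [yCoord]; ring

theorem zeta_re : (zeta : ℂ).re = 1 / 2 := rfl

theorem zeta_im : (zeta : ℂ).im = √3 / 2 := rfl

@[simp] theorem xCoord_pt (a b : ℝ) : xCoord (pt a b) = a := by
  have h : √3 ≠ 0 := by positivity
  simp only [pt, xCoord_apply, Complex.add_re, Complex.ofReal_re, Complex.mul_re, zeta_re,
    Complex.ofReal_im, zeta_im, Complex.add_im, Complex.mul_im]
  field_simp
  ring

@[simp] theorem yCoord_pt (a b : ℝ) : yCoord (pt a b) = b := by
  have h : √3 ≠ 0 := by positivity
  simp only [pt, yCoord_apply, Complex.add_im, Complex.ofReal_re, zeta_re,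
    Complex.ofReal_im, zeta_im, Complex.mul_im]
  field_simp
  ring

theorem coord_ext {z w : ℂ} (h1 : xCoord z = xCoord w) (h2 : yCoord z = yCoord w) : z = w := by
  have h : √3 ≠ 0 := by positivity
  simp only [xCoord_apply, yCoord_apply] at h1 h2
  have h3 : z.im = w.im := by field_simp at h2; linarith
  rw [h3] at h1
  exact Complex.ext (by linarith) h3

theorem pt_coord (z : ℂ) : pt (xCoord z) (yCoord z) = z := coord_ext (by simp) (by simp)

@[fun_prop] theorem continuous_xCoord : Continuous xCoord :=
  xCoord.continuous_of_finiteDimensional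

@[fun_prop] theorem continuous_yCoord : Continuous yCoord :=
  yCoord.continuous_of_finiteDimensional

@[simp] theorem xCoord_zeta_mul (z : ℂ) : xCoord (zeta * z) = -yCoord z := by
  have h : √3 * √3 = 3 := Real.mul_self_sqrt (by norm_num)
  have h0 : √3 ≠ 0 := by positivity
  simp only [xCoord_apply, yCoord_apply, Complex.mul_re, Complex.mul_im, zeta_re, zeta_im]
  field_simp
  linear_combination (-z.im) * h

@[simp] theorem yCoord_zeta_mul (z : ℂ) : yCoord (zeta * z) = xCoord z + yCoord z := by
  have h0 : √3 ≠ 0 := by positivity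
  simp only [xCoord_apply, yCoord_apply, Complex.mul_im, zeta_re, zeta_im]
  field_simp
  ring

theorem norm_sq_coord (z : ℂ) :
    ‖z‖ ^ 2 = xCoord z ^ 2 + xCoord z * yCoord z + yCoord z ^ 2 := by
  have h : √3 ^ 2 = 3 := Real.sq_sqrt (by norm_num)
  have h0 : √3 ≠ 0 := by positivity
  rw [Complex.sq_norm, Complex.normSq_apply, xCoord_apply, yCoord_apply]
  field_simp
  rw [h]
  linear_combination (-z.re ^ 2) * h

theorem coord_conj (z : ℂ) : xCoord ((starRingEnd ℂ) z) = xCoord z + yCoord z ∧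
    yCoord ((starRingEnd ℂ) z) = -yCoord z := by
  simp only [xCoord_apply, yCoord_apply, Complex.conj_re, Complex.conj_im]
  constructor <;> ring

theorem pt_add (a b c d : ℝ) : pt a b + pt c d = pt (a + c) (b + d) :=
  coord_ext (by simp) (by simp)

theorem pt_sub (a b c d : ℝ) : pt a b - pt c d = pt (a - c) (b - d) :=
  coord_ext (by simp) (by simp)

theorem neg_pt (a b : ℝ) : -pt a b = pt (-a) (-b) :=
  coord_ext (by simp) (by simp)

theorem two_mul_pt (a b : ℝ) : 2 * pt a b = pt (2 * a) (2 * b) := by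
  simp only [pt]; push_cast; ring

theorem zeta_mul_pt (a b : ℝ) : zeta * pt a b = pt (-b) (a + b) :=
  coord_ext (by simp) (by simp)

theorem v₀_eq : v₀ = pt 1 0 := by simp [v₀, pt]

theorem v₁_eq : v₁ = pt (-1) 1 := by
  apply Complex.ext <;> simp [v₁, pt, zeta_re, zeta_im]
  norm_num

theorem v₂_eq : v₂ = pt 0 (-1) := by
  apply Complex.ext <;> simp [v₂, pt, zeta_re, zeta_im]
  norm_num

theorem hexagonVertices_zero : hexagonVertices 0 =
    {pt 1 0, pt (-1) 1, pt 0 (-1), pt (-1) 0, pt 1 (-1), pt 0 1} := by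
  simp [hexagonVertices, v₀_eq, v₁_eq, v₂_eq, neg_pt]

theorem pt_mem_lattice (m n : ℤ) : pt m n ∈ eisensteinLattice := by
  have h0 : pt 1 0 ∈ eisensteinLattice :=
    mem_lattice_of_mem_hexagonVertices (by simp [hexagonVertices_zero])
  have h1 : pt 0 1 ∈ eisensteinLattice :=
    mem_lattice_of_mem_hexagonVertices (by simp [hexagonVertices_zero])
  convert add_mem (zsmul_mem h0 m) (zsmul_mem h1 n) using 1
  exact coord_ext (by simp [-zsmul_eq_mul]) (by simp [-zsmul_eq_mul])

theorem mem_lattice_iff {z : ℂ} : z ∈ eisensteinLattice ↔ ∃ m n : ℤ, z = pt m n := by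
  constructor
  · intro h
    induction h using AddSubgroup.closure_induction with
    | mem v hv =>
      simp only [mem_insert_iff, mem_singleton_iff] at hv
      rcases hv with rfl | rfl | rfl
      exacts [⟨1, 0, by simp [v₀_eq]⟩, ⟨-1, 1, by simp [v₁_eq]⟩, ⟨0, -1, by simp [v₂_eq]⟩]
    | zero => exact ⟨0, 0, by simp [pt]⟩
    | add a b _ _ ha hb =>
      obtain ⟨m, n, rfl⟩ := ha
      obtain ⟨k, l, rfl⟩ := hb
      exact ⟨m + k, n + l, by rw [pt_add]; push_cast; rfl⟩
    | neg a _ ha =>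
      obtain ⟨m, n, rfl⟩ := ha
      exact ⟨-m, -n, by rw [neg_pt]; push_cast; rfl⟩
  · rintro ⟨m, n, rfl⟩
    exact pt_mem_lattice m n

/-- Lattice points that are not in the doubled lattice are vertices of the tiling. -/
theorem pt_mem_vertices {m n : ℤ} (h : ¬(Even m ∧ Even n)) : pt m n ∈ vertices := by
  have key : ∀ k l : ℤ, ∀ a b : ℝ, pt a b ∈ hexagonVertices 0 →
      pt (2 * k + a) (2 * l + b) ∈ vertices := fun k l a b hab =>
    ⟨pt k l, pt_mem_lattice k l, by
      rw [mem_hexagonVertices_iff, two_mul_pt, pt_sub]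
      simpa using hab⟩
  simp only [hexagonVertices_zero] at key
  rcases Int.even_or_odd' m with ⟨k, rfl | rfl⟩ <;> rcases Int.even_or_odd' n with ⟨l, rfl | rfl⟩
  · simp at h
  · simpa using key k l 0 1 (by simp)
  · simpa using key k l 1 0 (by simp)
  · have := key k (l + 1) 1 (-1) (by simp)
    push_cast at this ⊢
    convert this using 2; ring

theorem isEdge_pt {m n k l : ℤ} (h : ¬(Even m ∧ Even n)) (h' : ¬(Even k ∧ Even l))
    (hd : (m - k) ^ 2 + (m - k) * (n - l) + (n - l) ^ 2 = 1) : IsEdge (pt m n) (pt k l) := by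
  refine ⟨pt_mem_vertices h, pt_mem_vertices h', ?_⟩
  rw [dist_eq_norm, ← pow_eq_one_iff_of_nonneg (norm_nonneg _) two_ne_zero, norm_sq_coord, pt_sub,
    xCoord_pt, yCoord_pt]
  exact_mod_cast hd

/-! ### Rotations by sixth roots of unity, and complex conjugation -/

theorem coord_zeta_pow_two (z : ℂ) : xCoord ((zeta : ℂ) ^ 2 * z) = -xCoord z - yCoord z ∧
    yCoord ((zeta : ℂ) ^ 2 * z) = xCoord z := by
  rw [pow_two, mul_assoc]; simp; ring

theorem zeta_pow_three : (zeta : ℂ) ^ 3 = -1 := by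
  have h : ∀ z, xCoord ((zeta : ℂ) ^ 3 * z) = -xCoord z ∧ yCoord ((zeta : ℂ) ^ 3 * z) = -yCoord z := by
    intro z
    rw [pow_succ, mul_assoc, (coord_zeta_pow_two _).1, (coord_zeta_pow_two _).2]
    simp
  have h1 := h 1
  rw [mul_one] at h1
  exact coord_ext (by rw [h1.1]; simp) (by rw [h1.2]; simp)

theorem zeta_mul_mem {v : ℂ} (hv : v ∈ hexagonVertices 0) :
    zeta * v ∈ hexagonVertices 0 := by
  simp only [hexagonVertices_zero, mem_insert_iff, mem_singleton_iff] at hv ⊢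
  rcases hv with rfl | rfl | rfl | rfl | rfl | rfl <;> rw [zeta_mul_pt] <;> norm_num

theorem zeta_pow_mul_mem (k : ℕ) {v : ℂ} (hv : v ∈ hexagonVertices 0) :
    (zeta : ℂ) ^ k * v ∈ hexagonVertices 0 := by
  induction k with
  | zero => simpa
  | succ k ih => rw [pow_succ', mul_assoc]; exact zeta_mul_mem ih

theorem zeta_pow_six : zeta ^ 6 = 1 := by
  ext
  push_cast
  rw [show 6 = 3 * 2 from rfl, pow_mul, zeta_pow_three]
  norm_num

theorem zeta_inv_pow (k : ℕ) : (zeta ^ k)⁻¹ = zeta ^ (5 * k) := by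
  rw [inv_eq_iff_mul_eq_one, ← pow_add, show k + 5 * k = 6 * k by ring, pow_mul, zeta_pow_six,
    one_pow]

theorem zeta_pow_four : (zeta : ℂ) ^ 4 = -zeta := by
  rw [show 4 = 3 + 1 from rfl, pow_succ, zeta_pow_three]; ring

theorem zeta_pow_five : (zeta : ℂ) ^ 5 = -zeta ^ 2 := by
  rw [show 5 = 3 + 2 from rfl, pow_add, zeta_pow_three]; ring

theorem coe_zeta_pow_six : (zeta : ℂ) ^ 6 = 1 := by
  exact_mod_cast congrArg Subtype.val zeta_pow_six

theorem zeta_pow_mul_mem_lattice (k : ℕ) {l : ℂ} (hl : l ∈ eisensteinLattice) :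
    (zeta : ℂ) ^ k * l ∈ eisensteinLattice := by
  induction k with
  | zero => simpa
  | succ k ih =>
    obtain ⟨a, b, hab⟩ := mem_lattice_iff.1 ih
    rw [pow_succ', mul_assoc, hab, zeta_mul_pt]
    simpa using pt_mem_lattice (-b) (a + b)

theorem isTilingSymmetry_rotation (k : ℕ) {l : ℂ} (hl : l ∈ eisensteinLattice) :
    IsTilingSymmetry (isometryOf (_root_.rotation (zeta ^ k)) (2 * l)) := by
  refine isTilingSymmetry_isometryOf (fun v hv => ?_) (fun v hv => ?_) hl
  · rw [rotation_apply, Circle.coe_pow]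
    exact zeta_pow_mul_mem k hv
  · rw [rotation_symm, rotation_apply, zeta_inv_pow, Circle.coe_pow]
    exact zeta_pow_mul_mem _ hv

theorem isTilingSymmetry_conj : IsTilingSymmetry (isometryOf Complex.conjLIE (2 * 0)) := by
  have h : ∀ v ∈ hexagonVertices 0, (starRingEnd ℂ) v ∈ hexagonVertices 0 := by
    have key : ∀ a b : ℝ, (starRingEnd ℂ) (pt a b) = pt (a + b) (-b) := fun a b =>
      coord_ext (by simp [coord_conj]) (by simp [coord_conj])
    intro v hv
    simp only [hexagonVertices_zero, mem_insert_iff, mem_singleton_iff] at hv ⊢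
    rcases hv with rfl | rfl | rfl | rfl | rfl | rfl <;> rw [key] <;> norm_num
  exact isTilingSymmetry_isometryOf (L := Complex.conjLIE) h h (zero_mem _)

/-! ### Hexagons, triangles and edges in coordinates -/

/-- The open regular hexagon with centre `c`, side length one and corners at the points
`c ± vᵢ`. -/
def hexInt (c : ℂ) : Set ℂ :=
  {z | |xCoord (z - c)| < 1 ∧ |yCoord (z - c)| < 1 ∧ |xCoord (z - c) + yCoord (z - c)| < 1}

theorem mem_hexInt_zero {z : ℂ} : z ∈ hexInt 0 ↔
    (-1 < xCoord z ∧ xCoord z < 1) ∧ (-1 < yCoord z ∧ yCoord z < 1) ∧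
      (-1 < xCoord z + yCoord z ∧ xCoord z + yCoord z < 1) := by
  simp [hexInt, abs_lt]

theorem mem_hexInt_iff_sub {c z : ℂ} : z ∈ hexInt c ↔ z - c ∈ hexInt 0 := by
  simp [hexInt]

theorem isOpen_hexInt (c : ℂ) : IsOpen (hexInt c) :=
  (isOpen_lt (by fun_prop) continuous_const).and
    ((isOpen_lt (by fun_prop) continuous_const).and (isOpen_lt (by fun_prop) continuous_const))

theorem zeta_mul_mem_hexInt {z : ℂ} (hz : z ∈ hexInt 0) : zeta * z ∈ hexInt 0 := by
  rw [mem_hexInt_zero] at *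
  simp only [xCoord_zeta_mul, yCoord_zeta_mul]
  refine ⟨⟨?_, ?_⟩, ⟨?_, ?_⟩, ⟨?_, ?_⟩⟩ <;> linarith

theorem zeta_pow_mul_mem_hexInt (k : ℕ) {z : ℂ} (hz : z ∈ hexInt 0) :
    (zeta : ℂ) ^ k * z ∈ hexInt 0 := by
  induction k with
  | zero => simpa
  | succ k ih => rw [pow_succ', mul_assoc]; exact zeta_mul_mem_hexInt ih

theorem zeta_pow_mul_mem_hexInt_iff (k : ℕ) {z : ℂ} :
    (zeta : ℂ) ^ k * z ∈ hexInt 0 ↔ z ∈ hexInt 0 := by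
  refine ⟨fun h => ?_, zeta_pow_mul_mem_hexInt k⟩
  have h1 := zeta_pow_mul_mem_hexInt (5 * k) h
  rw [← mul_assoc, ← pow_add, show 5 * k + k = 6 * k by ring, pow_mul] at h1
  simpa [coe_zeta_pow_six] using h1

/-- Two different hexagons of the tiling have disjoint interiors. -/
theorem hexInt_unique {c d z : ℂ} (hc : c ∈ eisensteinLattice) (hd : d ∈ eisensteinLattice)
    (h : z ∈ hexInt (2 * c)) (h' : z ∈ hexInt (2 * d)) : c = d := by
  obtain ⟨m, n, rfl⟩ := mem_lattice_iff.1 hc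
  obtain ⟨k, l, rfl⟩ := mem_lattice_iff.1 hd
  have key : ∀ (r : ℝ) (a b : ℤ), |r - 2 * a| < 1 → |r - 2 * b| < 1 → a = b := by
    intro r a b h1 h2
    rw [abs_lt] at h1 h2
    have h3 : (a : ℝ) < b + 1 := by linarith
    have h4 : (b : ℝ) < a + 1 := by linarith
    have h5 : a < b + 1 := by exact_mod_cast h3
    have h6 : b < a + 1 := by exact_mod_cast h4
    omega
  simp only [hexInt, two_mul_pt, map_sub, xCoord_pt, yCoord_pt, mem_ofPred_eq] at h h'
  rw [key _ _ _ h.1 h'.1, key _ _ _ h.2.1 h'.2.1]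

theorem notMem_hexInt_of_xCoord {c z : ℂ} (hc : c ∈ eisensteinLattice) (hz : xCoord z = 1) :
    z ∉ hexInt (2 * c) := by
  obtain ⟨m, n, rfl⟩ := mem_lattice_iff.1 hc
  rintro ⟨h, -⟩
  simp only [two_mul_pt, map_sub, xCoord_pt, hz, abs_lt] at h
  have h1 : (m : ℝ) < 1 := by linarith
  have h2 : (0 : ℝ) < m := by linarith
  have h3 : m < 1 := by exact_mod_cast h1
  have h4 : 0 < m := by exact_mod_cast h2
  omega

theorem notMem_hexInt_of_yCoord {c z : ℂ} (hc : c ∈ eisensteinLattice) (hz : yCoord z = 1) :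
    z ∉ hexInt (2 * c) := by
  obtain ⟨m, n, rfl⟩ := mem_lattice_iff.1 hc
  rintro ⟨-, h, -⟩
  simp only [two_mul_pt, map_sub, yCoord_pt, hz, abs_lt] at h
  have h1 : (n : ℝ) < 1 := by linarith
  have h2 : (0 : ℝ) < n := by linarith
  have h3 : n < 1 := by exact_mod_cast h1
  have h4 : 0 < n := by exact_mod_cast h2
  omega

theorem notMem_hexInt_of_add {c z : ℂ} (hc : c ∈ eisensteinLattice)
    (hz : xCoord z + yCoord z = 1) : z ∉ hexInt (2 * c) := by
  obtain ⟨m, n, rfl⟩ := mem_lattice_iff.1 hc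
  rintro ⟨-, -, h⟩
  simp only [two_mul_pt, map_sub, xCoord_pt, yCoord_pt, abs_lt] at h
  have h1 : ((m + n : ℤ) : ℝ) < 1 := by push_cast; linarith
  have h2 : (0 : ℝ) < (m + n : ℤ) := by push_cast; linarith
  have h3 : m + n < 1 := by exact_mod_cast h1
  have h4 : 0 < m + n := by exact_mod_cast h2
  omega

/-- The interior of the triangle with corners `(1, 0)`, `(1, -1)`, `(2, -1)`. -/
def lowerTriangle : Set ℂ := {z | 1 < xCoord z ∧ -1 < yCoord z ∧ xCoord z + yCoord z < 1}

/-- The interior of the triangle with corners `(0, 1)`, `(1, 0)`, `(1, 1)`. -/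
def upperTriangle : Set ℂ := {z | xCoord z < 1 ∧ yCoord z < 1 ∧ 1 < xCoord z + yCoord z}

theorem lowerTriangle_notMem_hexInt {c z : ℂ} (hc : c ∈ eisensteinLattice)
    (hz : z ∈ lowerTriangle) : z ∉ hexInt (2 * c) := by
  obtain ⟨m, n, rfl⟩ := mem_lattice_iff.1 hc
  rintro ⟨h1, h2, h3⟩
  obtain ⟨h4, h5, h6⟩ := hz
  simp only [two_mul_pt, map_sub, xCoord_pt, yCoord_pt, abs_lt] at h1 h2 h3
  have h7 : (0 : ℝ) < m := by linarith
  have h8 : (-1 : ℝ) < n := by linarith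
  have h9 : ((m + n : ℤ) : ℝ) < 1 := by push_cast; linarith
  have h10 : 0 < m := by exact_mod_cast h7
  have h11 : -1 < n := by exact_mod_cast h8
  have h12 : m + n < 1 := by exact_mod_cast h9
  omega

theorem upperTriangle_notMem_hexInt {c z : ℂ} (hc : c ∈ eisensteinLattice)
    (hz : z ∈ upperTriangle) : z ∉ hexInt (2 * c) := by
  obtain ⟨m, n, rfl⟩ := mem_lattice_iff.1 hc
  rintro ⟨h1, h2, h3⟩
  obtain ⟨h4, h5, h6⟩ := hz
  simp only [two_mul_pt, map_sub, xCoord_pt, yCoord_pt, abs_lt] at h1 h2 h3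
  have h7 : (m : ℝ) < 1 := by linarith
  have h8 : (n : ℝ) < 1 := by linarith
  have h9 : 0 < ((m + n : ℤ) : ℝ) := by push_cast; linarith
  have h10 : m < 1 := by exact_mod_cast h7
  have h11 : n < 1 := by exact_mod_cast h8
  have h12 : 0 < m + n := by exact_mod_cast h9
  omega

theorem mem_convexHull_of_coord {s : Set ℂ} {a b c z : ℂ} (ha : a ∈ convexHull ℝ s)
    (hb : b ∈ convexHull ℝ s) (hc : c ∈ convexHull ℝ s) (p q r : ℝ) (hp : 0 ≤ p) (hq : 0 ≤ q)
    (hr : 0 ≤ r) (h : p + q + r = 1)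
    (hx : xCoord z = p * xCoord a + q * xCoord b + r * xCoord c)
    (hy : yCoord z = p * yCoord a + q * yCoord b + r * yCoord c) : z ∈ convexHull ℝ s := by
  have h1 := (convex_convexHull ℝ s).sum_mem (t := Finset.univ) (w := ![p, q, r])
    (z := ![a, b, c]) (by simp [Fin.forall_fin_succ, hp, hq, hr])
    (by simp [Fin.sum_univ_three, h]) (by simp [Fin.forall_fin_succ, ha, hb, hc])
  convert h1 using 1
  apply coord_ext
  · simp [Fin.sum_univ_three, hx, -Complex.real_smul]
  · simp [Fin.sum_univ_three, hy, -Complex.real_smul]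

theorem hexInt_subset_interior :
    hexInt 0 ⊆ interior (convexHull ℝ (hexagonVertices 0)) := by
  refine interior_maximal (fun z hz => ?_) (isOpen_hexInt 0)
  obtain ⟨⟨h1, h2⟩, ⟨h3, h4⟩, h5, h6⟩ := mem_hexInt_zero.1 hz
  rw [hexagonVertices_zero]
  set s : Set ℂ := {pt 1 0, pt (-1) 1, pt 0 (-1), pt (-1) 0, pt 1 (-1), pt 0 1} with hs
  have k1 : pt 1 0 ∈ convexHull ℝ s := subset_convexHull ℝ s (by simp [hs])
  have k2 : pt (-1) 1 ∈ convexHull ℝ s := subset_convexHull ℝ s (by simp [hs])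
  have k3 : pt 0 (-1) ∈ convexHull ℝ s := subset_convexHull ℝ s (by simp [hs])
  have k4 : pt (-1) 0 ∈ convexHull ℝ s := subset_convexHull ℝ s (by simp [hs])
  have k5 : pt 1 (-1) ∈ convexHull ℝ s := subset_convexHull ℝ s (by simp [hs])
  have k6 : pt 0 1 ∈ convexHull ℝ s := subset_convexHull ℝ s (by simp [hs])
  have k0 : pt 0 0 ∈ convexHull ℝ s := by
    refine mem_convexHull_of_coord k1 k4 k4 (1 / 2) (1 / 2) 0 ?_ ?_ ?_ ?_ ?_ ?_ <;> norm_num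
  rcases le_total 0 (xCoord z) with hx | hx <;> rcases le_total 0 (yCoord z) with hy | hy
  · refine mem_convexHull_of_coord k1 k6 k0 (xCoord z) (yCoord z) (1 - xCoord z - yCoord z)
      hx hy ?_ ?_ ?_ ?_ <;> (try simp); linarith
  · rcases le_total 0 (xCoord z + yCoord z) with hw | hw
    · refine mem_convexHull_of_coord k5 k1 k0 (-yCoord z) (xCoord z + yCoord z) (1 - xCoord z)
        ?_ hw ?_ ?_ ?_ ?_ <;> (try simp) <;> linarith
    · refine mem_convexHull_of_coord k5 k3 k0 (xCoord z) (-xCoord z - yCoord z) (1 + yCoord z)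
        hx ?_ ?_ ?_ ?_ ?_ <;> (try simp) <;> linarith
  · rcases le_total 0 (xCoord z + yCoord z) with hw | hw
    · refine mem_convexHull_of_coord k2 k6 k0 (-xCoord z) (xCoord z + yCoord z) (1 - yCoord z)
        ?_ hw ?_ ?_ ?_ ?_ <;> (try simp) <;> linarith
    · refine mem_convexHull_of_coord k2 k4 k0 (yCoord z) (-xCoord z - yCoord z) (1 + xCoord z)
        hy ?_ ?_ ?_ ?_ ?_ <;> (try simp) <;> linarith
  · refine mem_convexHull_of_coord k4 k3 k0 (-xCoord z) (-yCoord z) (1 + xCoord z + yCoord z)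
      ?_ ?_ ?_ ?_ ?_ ?_ <;> (try simp) <;> linarith

theorem hexInt_subset_tile : ∃ P ∈ tiles, hexInt 0 ⊆ interior P :=
  ⟨_, Or.inl ⟨0, zero_mem _, rfl⟩, by simpa using hexInt_subset_interior⟩

theorem lowerTriangle_subset_tile : ∃ P ∈ tiles, lowerTriangle ⊆ interior P := by
  refine ⟨convexHull ℝ {pt (1 : ℤ) (0 : ℤ), pt (1 : ℤ) (-1 : ℤ), pt (2 : ℤ) (-1 : ℤ)},
    Or.inr ⟨_, _, _, ?_, ?_, ?_, rfl⟩, interior_maximal (fun z hz => ?_) ?_⟩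
  · exact isEdge_pt (by decide) (by decide) (by norm_num)
  · exact isEdge_pt (by decide) (by decide) (by norm_num)
  · exact isEdge_pt (by decide) (by decide) (by norm_num)
  · obtain ⟨h1, h2, h3⟩ := hz
    refine mem_convexHull_of_coord (subset_convexHull ℝ _ (mem_insert _ _))
      (subset_convexHull ℝ _ (mem_insert_of_mem _ (mem_insert _ _)))
      (subset_convexHull ℝ _ (mem_insert_of_mem _ (mem_insert_of_mem _ rfl)))
      (yCoord z + 1) (1 - xCoord z - yCoord z) (xCoord z - 1) ?_ ?_ ?_ ?_ ?_ ?_ <;> (try simp) <;>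
      linarith
  · exact (isOpen_lt continuous_const (by fun_prop)).and
      ((isOpen_lt continuous_const (by fun_prop)).and (isOpen_lt (by fun_prop) continuous_const))

theorem upperTriangle_subset_tile : ∃ P ∈ tiles, upperTriangle ⊆ interior P := by
  refine ⟨convexHull ℝ {pt (0 : ℤ) (1 : ℤ), pt (1 : ℤ) (0 : ℤ), pt (1 : ℤ) (1 : ℤ)},
    Or.inr ⟨_, _, _, ?_, ?_, ?_, rfl⟩, interior_maximal (fun z hz => ?_) ?_⟩
  · exact isEdge_pt (by decide) (by decide) (by norm_num)
  · exact isEdge_pt (by decide) (by decide) (by norm_num)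
  · exact isEdge_pt (by decide) (by decide) (by norm_num)
  · obtain ⟨h1, h2, h3⟩ := hz
    refine mem_convexHull_of_coord (subset_convexHull ℝ _ (mem_insert _ _))
      (subset_convexHull ℝ _ (mem_insert_of_mem _ (mem_insert _ _)))
      (subset_convexHull ℝ _ (mem_insert_of_mem _ (mem_insert_of_mem _ rfl)))
      (1 - xCoord z) (1 - yCoord z) (xCoord z + yCoord z - 1) ?_ ?_ ?_ ?_ ?_ ?_ <;> (try simp) <;>
      linarith
  · exact (isOpen_lt (by fun_prop) continuous_const).and
      ((isOpen_lt (by fun_prop) continuous_const).and (isOpen_lt continuous_const (by fun_prop)))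

theorem mem_openSegment_of_coord {a b z : ℂ} (t : ℝ) (h0 : 0 < t) (h1 : t < 1)
    (hx : xCoord z = (1 - t) * xCoord a + t * xCoord b)
    (hy : yCoord z = (1 - t) * yCoord a + t * yCoord b) : z ∈ openSegment ℝ a b := by
  refine ⟨1 - t, t, by linarith, h0, by ring, ?_⟩
  apply coord_ext
  · simp [hx, -Complex.real_smul]
  · simp [hy, -Complex.real_smul]

/-- Up to a symmetry of the tiling, each point of the plane that is not a vertex is in the hexagon
with centre zero, or in a given triangle, or on a given edge. -/
theorem cover {z : ℂ} (hz : z ∉ vertices) : ∃ (k : ℕ) (l : ℂ), l ∈ eisensteinLattice ∧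
    let w := isometryOf (_root_.rotation (zeta ^ k)) (2 * l) z
    w ∈ hexInt 0 ∨ w ∈ upperTriangle ∨ xCoord w = 1 ∧ -1 < yCoord w ∧ yCoord w < 0 := by
  have hmap : ∀ (k : ℕ) (m n : ℤ), ∃ l ∈ eisensteinLattice,
      isometryOf (_root_.rotation (zeta ^ k)) (2 * l) z =
        (zeta : ℂ) ^ k * pt (xCoord z - 2 * m) (yCoord z - 2 * n) := by
    intro k m n
    refine ⟨_, zeta_pow_mul_mem_lattice k (pt_mem_lattice (-m) (-n)), ?_⟩
    simp only [isometryOf_apply, rotation_apply, Circle.coe_pow]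
    rw [mul_left_comm, ← mul_add, two_mul_pt]
    congr 1
    conv_lhs => rw [← pt_coord z]
    rw [pt_add]
    congr 1 <;> push_cast <;> ring
  suffices h : ∃ (k : ℕ) (m n : ℤ),
      let w := (zeta : ℂ) ^ k * pt (xCoord z - 2 * m) (yCoord z - 2 * n)
      w ∈ hexInt 0 ∨ w ∈ upperTriangle ∨ xCoord w = 1 ∧ -1 < yCoord w ∧ yCoord w < 0 by
    obtain ⟨k, m, n, h⟩ := h
    obtain ⟨l, hl, h'⟩ := hmap k m n
    exact ⟨k, l, hl, by rw [h']; exact h⟩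
  have hint : ∀ k l : ℤ, ¬(Even k ∧ Even l) → xCoord z = k → yCoord z = l → False := by
    intro k l hkl h1 h2
    apply hz
    rw [← pt_coord z, h1, h2]
    exact pt_mem_vertices hkl
  have hround : ∀ r : ℝ, ∃ m : ℤ, -1 ≤ r - 2 * m ∧ r - 2 * m < 1 := by
    intro r
    refine ⟨⌊(r + 1) / 2⌋, ?_, ?_⟩
    · linarith [Int.floor_le ((r + 1) / 2)]
    · linarith [Int.lt_floor_add_one ((r + 1) / 2)]
  obtain ⟨m, hm1, hm2⟩ := hround (xCoord z)
  obtain ⟨n, hn1, hn2⟩ := hround (yCoord z)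
  set x := xCoord z with hx
  set y := yCoord z with hy
  have e2 : ∀ w, xCoord ((zeta : ℂ) ^ 2 * w) = -xCoord w - yCoord w := fun w =>
    (coord_zeta_pow_two w).1
  have e2' : ∀ w, yCoord ((zeta : ℂ) ^ 2 * w) = xCoord w := fun w => (coord_zeta_pow_two w).2
  rcases hm1.eq_or_lt with hm1 | hm1
  · -- on the line `x = -1`
    rcases lt_trichotomy (y - 2 * n) 0 with h | h | h
    · rcases hn1.eq_or_lt with hn1 | hn1
      · exact (hint (2 * m - 1) (2 * n - 1) (by simp) (by push_cast; linarith)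
          (by push_cast; linarith)).elim
      · refine ⟨0, m - 1, n, Or.inr (Or.inr ?_)⟩
        simp only [pow_zero, one_mul, xCoord_pt, yCoord_pt]
        push_cast
        refine ⟨?_, ?_, ?_⟩ <;> linarith
    · exact (hint (2 * m - 1) (2 * n) (by simp) (by push_cast; linarith)
        (by push_cast; linarith)).elim
    · refine ⟨3, m, n, Or.inr (Or.inr ?_)⟩
      simp only [zeta_pow_three, neg_one_mul, map_neg, xCoord_pt, yCoord_pt]
      refine ⟨?_, ?_, ?_⟩ <;> linarith
  rcases hn1.eq_or_lt with hn1 | hn1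
  · -- on the line `y = -1`
    rcases lt_trichotomy (x - 2 * m) 0 with h | h | h
    · refine ⟨4, m, n - 1, Or.inr (Or.inr ?_)⟩
      simp only [zeta_pow_four, neg_mul, map_neg, xCoord_zeta_mul, yCoord_zeta_mul, xCoord_pt, yCoord_pt]
      push_cast
      refine ⟨?_, ?_, ?_⟩ <;> linarith
    · exact (hint (2 * m) (2 * n - 1) (by simp) (by push_cast; linarith)
        (by push_cast; linarith)).elim
    · refine ⟨1, m, n, Or.inr (Or.inr ?_)⟩
      simp only [pow_one, xCoord_zeta_mul, yCoord_zeta_mul, xCoord_pt, yCoord_pt]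
      refine ⟨?_, ?_, ?_⟩ <;> linarith
  rcases lt_trichotomy (x - 2 * m + (y - 2 * n)) (-1) with h | h | h
  · refine ⟨3, m, n, Or.inr (Or.inl ?_)⟩
    simp only [upperTriangle, mem_ofPred_eq, zeta_pow_three, neg_one_mul, map_neg, xCoord_pt,
      yCoord_pt]
    refine ⟨?_, ?_, ?_⟩ <;> linarith
  · refine ⟨2, m, n, Or.inr (Or.inr ?_)⟩
    simp only [e2, e2', xCoord_pt, yCoord_pt]
    refine ⟨?_, ?_, ?_⟩ <;> linarith
  rcases lt_trichotomy (x - 2 * m + (y - 2 * n)) 1 with h' | h' | h'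
  · refine ⟨0, m, n, Or.inl ?_⟩
    simp only [mem_hexInt_zero, pow_zero, one_mul, xCoord_pt, yCoord_pt]
    refine ⟨⟨?_, ?_⟩, ⟨?_, ?_⟩, ⟨?_, ?_⟩⟩ <;> linarith
  · refine ⟨5, m, n, Or.inr (Or.inr ?_)⟩
    simp only [zeta_pow_five, neg_mul, map_neg, e2, e2', xCoord_pt, yCoord_pt]
    refine ⟨?_, ?_, ?_⟩ <;> linarith
  · refine ⟨0, m, n, Or.inr (Or.inl ?_)⟩
    simp only [upperTriangle, mem_ofPred_eq, pow_zero, one_mul, xCoord_pt, yCoord_pt]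
    refine ⟨?_, ?_, ?_⟩ <;> linarith

/-! ### The refractive flow -/

/-- Continuous induction on a half-line. -/
theorem real_induction {P : ℝ → Prop} {a : ℝ} (h0 : P a)
    (hstep : ∀ t, a ≤ t → (∀ r ∈ Icc a t, P r) → ∀ᶠ s in 𝓝[>] t, P s)
    (hlim : ∀ t, a < t → (∀ r ∈ Ico a t, P r) → P t) {t : ℝ} (ht : a ≤ t) : P t := by
  by_contra hP
  set F := {s | a ≤ s ∧ ¬P s} with hF
  have hne : F.Nonempty := ⟨t, ht, hP⟩
  have hbd : BddBelow F := ⟨a, fun s hs => hs.1⟩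
  have hac : a ≤ sInf F := le_csInf hne fun s hs => hs.1
  have h1 : ∀ r ∈ Ico a (sInf F), P r := fun r hr => by
    by_contra h
    exact (csInf_le hbd (show r ∈ F from ⟨hr.1, h⟩)).not_gt hr.2
  have h2 : P (sInf F) := by
    rcases hac.eq_or_lt with h | h
    · rwa [← h]
    · exact hlim _ h h1
  have h3 : ∀ r ∈ Icc a (sInf F), P r := fun r hr => by
    rcases hr.2.eq_or_lt with h | h
    · rwa [h]
    · exact h1 r ⟨hr.1, h⟩
  obtain ⟨c, hc, h4⟩ := (mem_nhdsGT_iff_exists_Ioo_subset).1 (hstep _ hac h3)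
  obtain ⟨s, hs, hsc⟩ := exists_lt_of_csInf_lt hne hc
  rcases (csInf_le hbd hs).eq_or_lt with h | h
  · exact hs.2 (h ▸ h2)
  · exact hs.2 (h4 ⟨h, hsc⟩)

theorem straight_self (x : UnitTangentBundle) (t : ℝ) : straight x t t = x := by
  simp [straight]

theorem straight_straight (x : UnitTangentBundle) (t s r : ℝ) :
    straight (straight x t s) s r = straight x t r := by
  simp only [straight, add_assoc, ← add_smul]
  congr 3; ring

/-- A point is in the interior of a tile. -/
def InTile (z : ℂ) : Prop := ∃ P ∈ tiles, z ∈ interior P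

theorem InTile.of_symmetry {f : ℂ ≃ᵃⁱ[ℝ] ℂ} (hf : IsTilingSymmetry f) {z : ℂ}
    (hz : InTile (f z)) : InTile z := by
  obtain ⟨P, hP, hz⟩ := hz
  refine ⟨_, hf.symm.mem_tiles hP, ?_⟩
  have h := f.symm.toHomeomorph.image_interior P
  simp only [AffineIsometryEquiv.coe_toHomeomorph] at h
  rw [← h]
  exact ⟨_, hz, by simp⟩

theorem inTile_of_mem_hexInt_zero {z : ℂ} (hz : z ∈ hexInt 0) : InTile z :=
  let ⟨P, hP, h⟩ := hexInt_subset_tile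
  ⟨P, hP, h hz⟩

theorem inTile_of_mem_lowerTriangle {z : ℂ} (hz : z ∈ lowerTriangle) : InTile z :=
  let ⟨P, hP, h⟩ := lowerTriangle_subset_tile
  ⟨P, hP, h hz⟩

theorem inTile_of_mem_upperTriangle {z : ℂ} (hz : z ∈ upperTriangle) : InTile z :=
  let ⟨P, hP, h⟩ := upperTriangle_subset_tile
  ⟨P, hP, h hz⟩

/-- The tiling covers the plane. -/
theorem inTile_or_mem_edge {z : ℂ} (hz : z ∉ vertices) :
    InTile z ∨ ∃ a b, IsEdge a b ∧ z ∈ openSegment ℝ a b := by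
  obtain ⟨k, l, hl, h⟩ := cover hz
  have hf := isTilingSymmetry_rotation k hl
  set f := isometryOf (_root_.rotation (zeta ^ k)) (2 * l)
  rcases h with h | h | ⟨h1, h2, h3⟩
  · exact Or.inl (.of_symmetry hf (inTile_of_mem_hexInt_zero h))
  · exact Or.inl (.of_symmetry hf (inTile_of_mem_upperTriangle h))
  · have he : IsEdge (pt (1 : ℤ) (0 : ℤ)) (pt (1 : ℤ) (-1 : ℤ)) :=
      isEdge_pt (by decide) (by decide) (by norm_num)
    refine Or.inr ⟨_, _, hf.symm.isEdge he, ?_⟩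
    have h4 := image_openSegment ℝ f.symm.toAffineEquiv.toAffineMap
      (pt (1 : ℤ) (0 : ℤ)) (pt (1 : ℤ) (-1 : ℤ))
    refine h4 ▸ ⟨f z, ?_, f.symm_apply_apply z⟩
    exact mem_openSegment_of_coord (-yCoord (f z)) (by linarith) (by linarith) (by simp [h1])
      (by simp)

namespace IsTrajectory

variable {x y : ℝ → UnitTangentBundle}

theorem germ_right (hx : IsTrajectory x) (t : ℝ) :
    ∀ᶠ s in 𝓝[≥] t, x s = straight (x t) t s := by
  rcases inTile_or_mem_edge (hx.notMem_vertices t) with ⟨P, hP, h⟩ | ⟨a, b, hab, h⟩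
  · exact (hx.interior_tile t P hP h).filter_mono nhdsWithin_le_nhds
  · exact (hx.edge t a b hab h).1

/-- Just before the time `t` the motion is straight, in a direction `d` that determines the direction
at the time `t`. -/
theorem germ_left (hx : IsTrajectory x) (t : ℝ) :
    ∃ d : Circle, (∀ᶠ s in 𝓝[<] t, x s = straight ((x t).1, d) t s) ∧
      (InTile (x t).1 → (x t).2 = d) ∧
      ∀ a b, IsEdge a b → (x t).1 ∈ openSegment ℝ a b → ((x t).2 : ℂ) = refract (b - a) d := by
  have hex : ∃ d : Circle, ∀ᶠ s in 𝓝[<] t, x s = straight ((x t).1, d) t s := by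
    rcases inTile_or_mem_edge (hx.notMem_vertices t) with ⟨P, hP, h⟩ | ⟨a, b, hab, h⟩
    · exact ⟨(x t).2, (hx.interior_tile t P hP h).filter_mono nhdsWithin_le_nhds⟩
    · obtain ⟨-, d, -, h⟩ := hx.edge t a b hab h
      exact ⟨d, h⟩
  obtain ⟨d, hd⟩ := hex
  have huniq : ∀ d' : Circle, (∀ᶠ s in 𝓝[<] t, x s = straight ((x t).1, d') t s) → d' = d := by
    intro d' hd'
    obtain ⟨s, h1, h2⟩ := (hd.and hd').exists
    exact congrArg Prod.snd (h2.symm.trans h1)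
  refine ⟨d, hd, ?_, ?_⟩
  · rintro ⟨P, hP, h⟩
    exact huniq _ ((hx.interior_tile t P hP h).filter_mono nhdsWithin_le_nhds)
  · intro a b hab h
    obtain ⟨-, d', h1, h2⟩ := hx.edge t a b hab h
    rw [h1, huniq d' h2]

/-- A motion that is straight before the time `s` determines the base point at the time `s`, and
the direction too. -/
theorem left_limit (hx : IsTrajectory x) {t s : ℝ} (hts : t < s)
    (h : ∀ r ∈ Ico t s, x r = straight (x t) t r) :
    (x s).1 = (x t).1 + (s - t) • ((x t).2 : ℂ) ∧ (InTile (x s).1 → (x s).2 = (x t).2) ∧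
      ∀ a b, IsEdge a b → (x s).1 ∈ openSegment ℝ a b →
        ((x s).2 : ℂ) = refract (b - a) (x t).2 := by
  obtain ⟨d, h1, h2, h3⟩ := hx.germ_left s
  obtain ⟨r, hr1, hr2⟩ := (h1.and (Ioo_mem_nhdsLT hts)).exists
  have h4 := hr1.symm.trans (h r ⟨hr2.1.le, hr2.2⟩)
  have hd : d = (x t).2 := congrArg Prod.snd h4
  subst hd
  refine ⟨?_, h2, h3⟩
  have h5 : (x s).1 + (r - s) • ((x t).2 : ℂ) = (x t).1 + (r - t) • ((x t).2 : ℂ) :=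
    congrArg Prod.fst h4
  rw [← sub_eq_iff_eq_add'] at h5 ⊢
  rw [show s - t = (r - t) - (r - s) by ring, sub_smul, ← h5]
  abel

/-- As long as a trajectory stays inside the tiles, it follows a straight line. The hypothesis may
use that it has done so. -/
theorem run_of_inTile (hx : IsTrajectory x) {t δ : ℝ}
    (h : ∀ s ∈ Ioo t (t + δ), (x s).1 = (x t).1 + (s - t) • ((x t).2 : ℂ) → InTile (x s).1) :
    ∀ s ∈ Ico t (t + δ), x s = straight (x t) t s := by
  suffices h : ∀ s, t ≤ s → s < t + δ → x s = straight (x t) t s from fun s hs => h s hs.1 hs.2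
  intro s hs
  refine real_induction (P := fun s => s < t + δ → x s = straight (x t) t s) ?_ ?_ ?_ hs
  · exact fun _ => (straight_self _ _).symm
  · intro s hs hind
    rcases lt_or_ge s (t + δ) with h1 | h1
    · have h2 := hind s ⟨hs, le_rfl⟩ h1
      filter_upwards [(hx.germ_right s).filter_mono (nhdsWithin_mono _ Ioi_subset_Ici_self)]
        with r hr _
      rw [hr, h2, straight_straight]
    · filter_upwards [self_mem_nhdsWithin] with r hr h2
      exact absurd (mem_Ioi.1 hr) (by linarith)
  · intro s hts hind h1
    obtain ⟨h2, h3, -⟩ := hx.left_limit hts fun r hr => hind r hr (hr.2.trans h1)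
    exact Prod.ext h2 (h3 (h s ⟨hts, h1⟩ h2))

/-- As long as the straight line stays inside the tiles, the trajectory follows it. -/
theorem run (hx : IsTrajectory x) {t δ : ℝ}
    (h : ∀ r ∈ Ioo 0 δ, InTile ((x t).1 + r • ((x t).2 : ℂ))) :
    ∀ s ∈ Ico t (t + δ), x s = straight (x t) t s :=
  hx.run_of_inTile fun s hs hst => hst ▸ h _ ⟨by linarith [hs.1], by linarith [hs.2]⟩

/-- A trajectory follows a straight line through the interior of a tile up to a point of an edge,
where it is refracted. -/
theorem cross (hx : IsTrajectory x) {t δ : ℝ} (hδ : 0 < δ)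
    (h : ∀ r ∈ Ioo 0 δ, InTile ((x t).1 + r • ((x t).2 : ℂ))) :
    (x (t + δ)).1 = (x t).1 + δ • ((x t).2 : ℂ) ∧
      ∀ a b, IsEdge a b → (x (t + δ)).1 ∈ openSegment ℝ a b →
        ((x (t + δ)).2 : ℂ) = refract (b - a) (x t).2 := by
  obtain ⟨h1, -, h2⟩ := hx.left_limit (by linarith) (hx.run h)
  exact ⟨by rw [h1, add_sub_cancel_left], h2⟩

/-- The flow is deterministic. -/
theorem forward_unique (hx : IsTrajectory x) (hy : IsTrajectory y) {t : ℝ} (h : x t = y t)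
    {s : ℝ} (hs : t ≤ s) : x s = y s := by
  refine real_induction (P := fun s => x s = y s) h ?_ ?_ hs
  · intro s hs hind
    filter_upwards [(hx.germ_right s).filter_mono (nhdsWithin_mono _ Ioi_subset_Ici_self),
      (hy.germ_right s).filter_mono (nhdsWithin_mono _ Ioi_subset_Ici_self)] with r h1 h2
    rw [h1, h2, hind s ⟨hs, le_rfl⟩]
  · intro s hts hind
    obtain ⟨d, h1, h2, h3⟩ := hx.germ_left s
    obtain ⟨d', h1', h2', h3'⟩ := hy.germ_left s
    obtain ⟨r, ⟨hr1, hr1'⟩, hr2⟩ := ((h1.and h1').and (Ioo_mem_nhdsLT hts)).exists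
    have h4 := hr1.symm.trans ((hind r ⟨hr2.1.le, hr2.2⟩).trans hr1')
    have hd : d = d' := congrArg Prod.snd h4
    subst hd
    have h5 : (x s).1 = (y s).1 := add_right_cancel (congrArg Prod.fst h4)
    refine Prod.ext h5 ?_
    rcases inTile_or_mem_edge (hx.notMem_vertices s) with h | ⟨a, b, hab, h⟩
    · rw [h2 h, h2' (h5 ▸ h)]
    · exact Circle.ext ((h3 a b hab h).trans (h3' a b hab (h5 ▸ h)).symm)

theorem comp_add (hx : IsTrajectory x) (c : ℝ) : IsTrajectory fun t => x (t + c) := by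
  have key : ∀ (z : UnitTangentBundle) (t s : ℝ), straight z (t + c) (s + c) = straight z t s := by
    intro z t s
    simp [straight]
  have hc : Continuous fun s : ℝ => s + c := by fun_prop
  refine ⟨fun t => hx.notMem_vertices _, fun t P hP h => ?_, fun t a b hab h => ?_⟩
  · have := (hc.tendsto t).eventually (hx.interior_tile _ P hP h)
    simpa only [key] using this
  · obtain ⟨h1, d, hd, h2⟩ := hx.edge _ a b hab h
    refine ⟨?_, d, hd, ?_⟩
    · have : Tendsto (fun s : ℝ => s + c) (𝓝[≥] t) (𝓝[≥] (t + c)) :=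
        hc.continuousWithinAt.tendsto_nhdsWithin fun s hs => by
          simpa using hs
      simpa only [key] using this.eventually h1
    · have : Tendsto (fun s : ℝ => s + c) (𝓝[<] t) (𝓝[<] (t + c)) :=
        hc.continuousWithinAt.tendsto_nhdsWithin fun s hs => by
          simpa using hs
      simpa only [key] using this.eventually h2

end IsTrajectory

/-! ### From one hexagon to the next -/

/-- The signed distance of the oriented line through `z` in the direction `u` from the origin, up
to a constant factor. It is positive if the origin is on the right of the line. -/
def offset (u z : ℂ) : ℝ := xCoord u * yCoord z - yCoord u * xCoord z

theorem offset_add_smul (u z : ℂ) (r : ℝ) : offset u (z + r • u) = offset u z := by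
  simp only [offset, map_add, map_smul, smul_eq_mul]; ring

theorem offset_zeta_mul (u z : ℂ) : offset (zeta * u) (zeta * z) = offset u z := by
  simp only [offset, xCoord_zeta_mul, yCoord_zeta_mul]; ring

theorem offset_zeta_pow_mul (k : ℕ) (u z : ℂ) :
    offset ((zeta : ℂ) ^ k * u) ((zeta : ℂ) ^ k * z) = offset u z := by
  induction k with
  | zero => simp
  | succ k ih => rw [pow_succ', mul_assoc, mul_assoc, offset_zeta_mul, ih]

/-- At the time `s` the trajectory `x` is in the hexagon with centre `2 * c`, and it moves in the
direction `u` on the line with offset `p` from the centre. -/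
def Passage (x : ℝ → UnitTangentBundle) (s : ℝ) (c u : ℂ) (p : ℝ) : Prop :=
  (x s).1 ∈ hexInt (2 * c) ∧ ((x s).2 : ℂ) = u ∧ offset u ((x s).1 - 2 * c) = p

/-- Refraction at an edge with unit direction `e`. For the six directions of edges, the coefficients
are integers. -/
theorem refract_coord {e : ℂ} (d : ℂ)
    (he : xCoord e ^ 2 + xCoord e * yCoord e + yCoord e ^ 2 = 1) :
    xCoord (refract e d) = xCoord d - (2 * xCoord e * xCoord d + 2 * yCoord e * yCoord d +
        xCoord e * yCoord d + yCoord e * xCoord d) * xCoord e ∧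
      yCoord (refract e d) = yCoord d - (2 * xCoord e * xCoord d + 2 * yCoord e * yCoord d +
        xCoord e * yCoord d + yCoord e * xCoord d) * yCoord e := by
  have hin : inner ℝ e d = xCoord e * xCoord d + yCoord e * yCoord d +
      (xCoord e * yCoord d + yCoord e * xCoord d) / 2 := by
    have h : √3 ^ 2 = 3 := Real.sq_sqrt (by norm_num)
    have h0 : √3 ≠ 0 := by positivity
    simp only [Complex.inner, xCoord_apply, yCoord_apply, Complex.mul_re, Complex.conj_re,
      Complex.conj_im]
    field_simp
    linear_combination (e.im * d.im) * h
  have h1 : refract e d = d - (2 * inner ℝ e d) • e := by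
    rw [refract, Submodule.reflection_singleton_apply, RCLike.ofReal_real_eq_id, id,
      norm_sq_coord e, he, div_one, two_smul, two_mul, add_smul]
    abel
  rw [h1]
  simp only [map_sub, map_smul, smul_eq_mul, hin]
  constructor <;> ring

theorem eventually_add_mul_lt {a b : ℝ} (c t : ℝ) (h : a < b) :
    ∀ᶠ s in 𝓝[>] t, a + (s - t) * c < b := by
  have hc : Continuous fun s : ℝ => a + (s - t) * c := by fun_prop
  exact ((hc.tendsto t).mono_left nhdsWithin_le_nhds).eventually
    (gt_mem_nhds (by simpa using h))

theorem eventually_lt_add_mul {a b : ℝ} (c t : ℝ) (h : b < a) :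
    ∀ᶠ s in 𝓝[>] t, b < a + (s - t) * c := by
  filter_upwards [eventually_add_mul_lt (-c) t (neg_lt_neg h)] with s hs
  linarith

/-- A line whose offset is between those of the centre and of the corner `(1, 0)` leaves the
hexagon with centre zero on the line `x = 1`. -/
theorem exit_right {u z : ℂ} (hz : z ∈ hexInt 0) (hη : yCoord u ≤ 0)
    (hξ : 0 < xCoord u + yCoord u) (hp : 0 ≤ offset u z) (hle : offset u z ≤ -yCoord u) :
    ∃ δ : ℝ, 0 < δ ∧ (∀ r ∈ Ioo 0 δ, z + r • u ∈ hexInt 0) ∧ xCoord (z + δ • u) = 1 ∧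
      xCoord u * yCoord (z + δ • u) = offset u z + yCoord u := by
  obtain ⟨⟨hX1, hX2⟩, ⟨hY1, hY2⟩, hS1, hS2⟩ := mem_hexInt_zero.1 hz
  have hoff : xCoord u * yCoord z - yCoord u * xCoord z = offset u z := rfl
  set p := offset u z
  set ξ := xCoord u with hξd
  set η := yCoord u with hηd
  set X := xCoord z with hX
  set Y := yCoord z with hY
  have hξ0 : 0 < ξ := by linarith
  refine ⟨(1 - X) / ξ, div_pos (by linarith) hξ0, ?_, ?_, ?_⟩
  · rintro r ⟨hr0, hr⟩
    rw [lt_div_iff₀ hξ0] at hr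
    rw [mem_hexInt_zero]
    simp only [map_add, map_smul, smul_eq_mul, ← hX, ← hY, ← hξd, ← hηd]
    have h1 : 0 < r * ξ := by positivity
    have h2 : r * η ≤ 0 := mul_nonpos_of_nonneg_of_nonpos hr0.le hη
    have h3 : 0 < r * (ξ + η) := by positivity
    have h4 : ξ * (Y + r * η) = p + η * (X + r * ξ) := by rw [← hoff]; ring
    have h5 : η * 1 ≤ η * (X + r * ξ) := mul_le_mul_of_nonpos_left (by linarith) hη
    have h6 : (ξ + η) * (X + r * ξ) < (ξ + η) * 1 := mul_lt_mul_of_pos_left (by linarith) hξ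
    have h7 : -1 < Y + r * η := by
      refine lt_of_mul_lt_mul_left ?_ hξ0.le
      linarith
    have h8 : X + r * ξ + (Y + r * η) < 1 := by
      refine lt_of_mul_lt_mul_left ?_ hξ0.le
      linarith
    refine ⟨⟨?_, ?_⟩, ⟨?_, ?_⟩, ⟨?_, ?_⟩⟩ <;> linarith
  · simp only [map_add, map_smul, smul_eq_mul, ← hX, ← hξd]
    field_simp; ring
  · rw [← hoff]
    simp only [map_add, map_smul, smul_eq_mul, ← hY, ← hηd]
    field_simp; ring

namespace IsTrajectory

variable {x : ℝ → UnitTangentBundle}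

/-- The passage from the hexagon with centre zero through a triangle to the next hexagon. -/
theorem next_passage (hx : IsTrajectory x) {t δ₁ δ₂ : ℝ} {W : Set ℂ} {c₁ : ℂ}
    (hW : ∀ z ∈ W, InTile z) (hW' : ∀ z ∈ W, ∀ c ∈ eisensteinLattice, z ∉ hexInt (2 * c))
    (hδ₁ : 0 < δ₁) (hδ₂ : 0 < δ₂) (h0 : (x t).1 ∈ hexInt 0)
    (h1 : ∀ r ∈ Ioo 0 δ₁, (x t).1 + r • ((x t).2 : ℂ) ∈ hexInt 0)
    (e1 : ∀ c ∈ eisensteinLattice, (x (t + δ₁)).1 ∉ hexInt (2 * c))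
    (h2 : ∀ r ∈ Ioo 0 δ₂, (x (t + δ₁)).1 + r • ((x (t + δ₁)).2 : ℂ) ∈ W)
    (e2 : ∀ c ∈ eisensteinLattice, (x (t + δ₁ + δ₂)).1 ∉ hexInt (2 * c))
    (h3 : ∀ᶠ s in 𝓝[>] (t + δ₁ + δ₂),
      (straight (x (t + δ₁ + δ₂)) (t + δ₁ + δ₂) s).1 ∈ hexInt (2 * c₁)) :
    ∃ t' > t, Passage x t' c₁ (x (t + δ₁ + δ₂)).2
        (offset (x (t + δ₁ + δ₂)).2 ((x (t + δ₁ + δ₂)).1 - 2 * c₁)) ∧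
      ∀ s ∈ Icc t t', ∀ c ∈ eisensteinLattice, (x s).1 ∈ hexInt (2 * c) →
        Passage x s 0 (x t).2 (offset (x t).2 (x t).1) ∨
        Passage x s c₁ (x (t + δ₁ + δ₂)).2
          (offset (x (t + δ₁ + δ₂)).2 ((x (t + δ₁ + δ₂)).1 - 2 * c₁)) := by
  set t₁ := t + δ₁ with ht₁
  set t₂ := t₁ + δ₂ with ht₂
  have h4 : ∀ᶠ s in 𝓝[>] t₂, Passage x s c₁ (x t₂).2 (offset (x t₂).2 ((x t₂).1 - 2 * c₁)) := by
    filter_upwards [h3, (hx.germ_right t₂).filter_mono (nhdsWithin_mono _ Ioi_subset_Ici_self)]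
      with s hs hs'
    refine ⟨hs' ▸ hs, by rw [hs']; rfl, ?_⟩
    rw [hs', straight, add_sub_right_comm, offset_add_smul]
  obtain ⟨t', ht', h5⟩ := (mem_nhdsGT_iff_exists_Ioc_subset).1 h4
  rw [mem_Ioi] at ht'
  refine ⟨t', by linarith, h5 ⟨ht', le_rfl⟩, ?_⟩
  intro s hs c hc hsc
  rcases lt_trichotomy s t₁ with h | h | h
  · left
    have hst := hx.run (fun r hr => inTile_of_mem_hexInt_zero (h1 r hr)) s ⟨hs.1, h⟩
    refine ⟨?_, by rw [hst]; rfl, ?_⟩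
    · rcases hs.1.eq_or_lt with rfl | h6
      · simpa using h0
      · rw [hst, mul_zero]
        exact h1 _ ⟨by linarith, by linarith⟩
    · rw [hst, mul_zero, sub_zero]
      exact offset_add_smul _ _ _
  · exact absurd hsc (h ▸ e1 c hc)
  · rcases lt_trichotomy s t₂ with h' | h' | h'
    · have hst := hx.run (fun r hr => hW _ (h2 r hr)) s ⟨h.le, h'⟩
      rw [hst] at hsc
      exact absurd hsc (hW' _ (h2 (s - t₁) ⟨by linarith, by linarith⟩) c hc)
    · exact absurd hsc (h' ▸ e2 c hc)
    · exact Or.inr (h5 ⟨h', hs.2⟩)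

/-- The next hexagon after a passage that leaves the hexagon with centre zero through the edge
from `(1, -1)` to `(1, 0)`: the trajectory turns around the vertex `(1, 0)`. -/
theorem next_passage_lower (hx : IsTrajectory x) {t p : ℝ} {u : ℂ} (h : Passage x t 0 u p)
    (hη : yCoord u ≤ 0) (hξ : 0 < xCoord u + yCoord u) (hp : 0 ≤ p) (hlt : p < -yCoord u) :
    0 < p ∧ ∃ t' > t, Passage x t' (pt 1 0) ((zeta : ℂ) ^ 2 * u) (p + (xCoord u + yCoord u)) ∧
      ∀ s ∈ Icc t t', ∀ c ∈ eisensteinLattice, (x s).1 ∈ hexInt (2 * c) →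
        Passage x s 0 u p ∨
        Passage x s (pt 1 0) ((zeta : ℂ) ^ 2 * u) (p + (xCoord u + yCoord u)) := by
  obtain ⟨hz, rfl, hoff⟩ := h
  rw [mul_zero] at hz hoff
  rw [sub_zero] at hoff
  set u : ℂ := ((x t).2 : ℂ) with hu
  obtain ⟨δ₁, hδ₁, h1, cx1, cy1⟩ := exit_right hz hη hξ (hoff ▸ hp) (hoff ▸ hlt.le)
  rw [hoff] at cy1
  set ξ := xCoord u with hξd
  set η := yCoord u with hηd
  have hξ0 : 0 < ξ := by linarith
  have hη0 : η < 0 := by linarith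
  have hη1 : η ≠ 0 := hη0.ne
  -- the first crossing, at the point `(1, Y₁)`
  obtain ⟨c1, d1⟩ := hx.cross hδ₁ fun r hr => inTile_of_mem_hexInt_zero (h1 r hr)
  set t₁ := t + δ₁ with ht₁
  rw [← hu] at c1 d1
  rw [← c1] at cx1 cy1
  set Y₁ := yCoord (x t₁).1 with hY₁
  have hY₁0 : Y₁ < 0 := by
    by_contra! hcon
    nlinarith
  have hY₁1 : -1 < Y₁ := by
    refine lt_of_mul_lt_mul_left ?_ hξ0.le
    linarith
  have s1 := d1 (pt (1 : ℤ) (0 : ℤ)) (pt (1 : ℤ) (-1 : ℤ))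
    (isEdge_pt (by decide) (by decide) (by norm_num))
    (mem_openSegment_of_coord (-Y₁) (by linarith) (by linarith) (by simp [cx1]) (by simp [hY₁]))
  obtain ⟨ux1, uy1⟩ := refract_coord (e := pt (1 : ℤ) (-1 : ℤ) - pt (1 : ℤ) (0 : ℤ)) u (by simp)
  rw [← s1] at ux1 uy1
  replace ux1 : xCoord (x t₁).2 = ξ := by simpa using ux1
  replace uy1 : yCoord (x t₁).2 = -ξ - η := by
    rw [uy1]; simp; ring
  -- the second crossing, at the point `(2 + p / η, -1 - p / η)`
  have hδ₂ : 0 < Y₁ / η := div_pos_of_neg_of_neg hY₁0 hη0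
  have h2 : ∀ r ∈ Ioo 0 (Y₁ / η), (x t₁).1 + r • ((x t₁).2 : ℂ) ∈ lowerTriangle := by
    rintro r ⟨hr0, hr⟩
    rw [lt_div_iff_of_neg hη0] at hr
    simp only [lowerTriangle, mem_ofPred_eq, map_add, map_smul, smul_eq_mul, cx1, ux1, uy1, ← hY₁]
    have h1 : 0 < r * ξ := by positivity
    have h3 : r * (ξ + η) < Y₁ + 1 := by
      refine lt_of_mul_lt_mul_left ?_ (neg_pos.2 hη0).le
      have : (ξ + η) * Y₁ < (ξ + η) * (r * η) := mul_lt_mul_of_pos_left hr hξ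
      linarith
    refine ⟨?_, ?_, ?_⟩ <;> linarith
  obtain ⟨c2, d2⟩ := hx.cross hδ₂ fun r hr => inTile_of_mem_lowerTriangle (h2 r hr)
  set t₂ := t₁ + Y₁ / η with ht₂
  have cx2 : xCoord (x t₂).1 = 2 + p / η := by
    rw [c2]
    simp only [map_add, map_smul, smul_eq_mul, cx1, ux1]
    field_simp; linarith
  have cy2 : yCoord (x t₂).1 = -1 - p / η := by
    rw [c2]
    simp only [map_add, map_smul, smul_eq_mul, ← hY₁, uy1]
    field_simp; linarith
  -- for `p = 0` this is the vertex `(2, -1)`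
  have hp0 : 0 < p := by
    refine lt_of_le_of_ne hp fun hp0 => hx.notMem_vertices t₂ ?_
    rw [← pt_coord (x t₂).1, cx2, cy2, ← hp0]
    simpa using pt_mem_vertices (m := 2) (n := -1) (by decide)
  have hq0 : p / η < 0 := div_neg_of_pos_of_neg hp0 hη0
  have hq1 : -1 < p / η := by rw [lt_div_iff_of_neg hη0]; linarith
  have s2 := d2 (pt (1 : ℤ) (0 : ℤ)) (pt (2 : ℤ) (-1 : ℤ))
    (isEdge_pt (by decide) (by decide) (by norm_num))
    (mem_openSegment_of_coord (1 + p / η) (by linarith) (by linarith)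
      (by simp [cx2]; ring) (by simp [cy2]; ring))
  obtain ⟨ux2, uy2⟩ := refract_coord (e := pt (2 : ℤ) (-1 : ℤ) - pt (1 : ℤ) (0 : ℤ))
    (x t₁).2 (by simp; norm_num)
  rw [← s2] at ux2 uy2
  replace ux2 : xCoord (x t₂).2 = -ξ - η := by
    rw [ux2, ux1, uy1]; simp; ring
  replace uy2 : yCoord (x t₂).2 = ξ := by
    rw [uy2, ux1, uy1]; simp; ring
  have hdir : ((x t₂).2 : ℂ) = (zeta : ℂ) ^ 2 * u := by
    apply coord_ext
    · rw [ux2, (coord_zeta_pow_two u).1]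
    · rw [uy2, (coord_zeta_pow_two u).2]
  have hoff2 : offset (x t₂).2 ((x t₂).1 - 2 * pt 1 0) = p + (ξ + η) := by
    simp only [offset, ux2, uy2, map_sub, two_mul_pt, xCoord_pt, yCoord_pt, cx2, cy2]
    field_simp; ring
  have h3 : ∀ᶠ s in 𝓝[>] t₂, (straight (x t₂) t₂ s).1 ∈ hexInt (2 * pt 1 0) := by
    filter_upwards [eventually_lt_add_mul (-ξ - η) t₂ hq1,
      eventually_add_mul_lt (ξ) t₂ (show -1 - p / η < 1 by linarith),
      eventually_add_mul_lt (-η) t₂ (show -1 < (1 : ℝ) by norm_num), self_mem_nhdsWithin]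
      with s e1 e2 e3 hs
    have hs' : 0 < s - t₂ := sub_pos.2 hs
    have k1 : 0 < (s - t₂) * ξ := by positivity
    have k2 : (s - t₂) * η < 0 := mul_neg_of_pos_of_neg hs' hη0
    have k3 : 0 < (s - t₂) * (ξ + η) := by positivity
    rw [mem_hexInt_iff_sub, mem_hexInt_zero]
    simp only [straight, map_sub, map_add, map_smul, smul_eq_mul, two_mul_pt, xCoord_pt,
      yCoord_pt, cx2, cy2, ux2, uy2]
    refine ⟨⟨?_, ?_⟩, ⟨?_, ?_⟩, ⟨?_, ?_⟩⟩ <;> linarith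
  have := hx.next_passage (fun z => inTile_of_mem_lowerTriangle)
    (fun z hz c hc => lowerTriangle_notMem_hexInt hc hz) hδ₁ hδ₂ hz h1
    (fun c hc => notMem_hexInt_of_xCoord hc cx1) h2
    (fun c hc => notMem_hexInt_of_add hc (by rw [cx2, cy2]; ring)) h3
  rw [hoff2, hdir, ← hu, hoff] at this
  exact ⟨hp0, this⟩

/-- The next hexagon after a passage that leaves the hexagon with centre zero through the edge
from `(1, 0)` to `(0, 1)`: the trajectory turns around the vertex `(0, 1)`. -/
theorem next_passage_upper (hx : IsTrajectory x) {t p : ℝ} {u : ℂ} (h : Passage x t 0 u p)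
    (hη : yCoord u ≤ 0) (hξ : 0 < xCoord u + yCoord u) (hlt : -yCoord u < p) :
    ∃ t' > t, Passage x t' (pt 0 1) ((zeta : ℂ) ^ 2 * u) (p + yCoord u) ∧
      ∀ s ∈ Icc t t', ∀ c ∈ eisensteinLattice, (x s).1 ∈ hexInt (2 * c) →
        Passage x s 0 u p ∨ Passage x s (pt 0 1) ((zeta : ℂ) ^ 2 * u) (p + yCoord u) := by
  obtain ⟨hz, rfl, hoff⟩ := h
  rw [mul_zero] at hz hoff
  rw [sub_zero] at hoff
  have hoff' := hoff
  obtain ⟨⟨hX1, hX2⟩, ⟨hY1, hY2⟩, hS1, hS2⟩ := mem_hexInt_zero.1 hz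
  rw [offset] at hoff
  set u : ℂ := ((x t).2 : ℂ) with hu
  set ξ := xCoord u with hξd
  set η := yCoord u with hηd
  set X := xCoord (x t).1 with hX
  set Y := yCoord (x t).1 with hY
  have hξ0 : 0 < ξ := by linarith
  have hpξ : p < ξ := by nlinarith
  -- the first crossing, at the point `(X₁, 1 - X₁)`
  have hδ₁ : 0 < (1 - X - Y) / (ξ + η) := div_pos (by linarith) hξ
  have h1 : ∀ r ∈ Ioo 0 ((1 - X - Y) / (ξ + η)), (x t).1 + r • u ∈ hexInt 0 := by
    rintro r ⟨hr0, hr⟩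
    rw [lt_div_iff₀ hξ] at hr
    rw [mem_hexInt_zero]
    simp only [map_add, map_smul, smul_eq_mul, ← hX, ← hY, ← hξd, ← hηd]
    have h1 : 0 < r * ξ := by positivity
    have h2 : r * η ≤ 0 := mul_nonpos_of_nonneg_of_nonpos hr0.le hη
    have h3 : 0 < r * (ξ + η) := by positivity
    have h4 : ξ * (Y + r * η) - η * (X + r * ξ) = p := by rw [← hoff]; ring
    have h5 : ξ * (X + r * ξ + (Y + r * η)) < ξ * 1 := mul_lt_mul_of_pos_left (by linarith) hξ0
    have h6 : η * 1 ≤ η * (X + r * ξ + (Y + r * η)) :=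
      mul_le_mul_of_nonpos_left (by linarith) hη
    have h7 : X + r * ξ < 1 := by
      refine lt_of_mul_lt_mul_left ?_ hξ.le
      linarith
    have h8 : -1 < Y + r * η := by
      refine lt_of_mul_lt_mul_left ?_ hξ.le
      linarith
    refine ⟨⟨?_, ?_⟩, ⟨?_, ?_⟩, ⟨?_, ?_⟩⟩ <;> linarith
  obtain ⟨c1, d1⟩ := hx.cross hδ₁ fun r hr => inTile_of_mem_hexInt_zero (h1 r hr)
  set t₁ := t + (1 - X - Y) / (ξ + η) with ht₁
  rw [← hu] at c1 d1
  set X₁ := xCoord (x t₁).1 with hX₁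
  have cx1 : (ξ + η) * X₁ = ξ - p := by
    rw [hX₁, c1, ← hoff]
    simp only [map_add, map_smul, smul_eq_mul, ← hX, ← hξd]
    field_simp; ring
  have cy1 : yCoord (x t₁).1 = 1 - X₁ := by
    rw [hX₁, c1]
    simp only [map_add, map_smul, smul_eq_mul, ← hX, ← hξd, ← hY, ← hηd]
    field_simp; ring
  have hX₁0 : 0 < X₁ := by
    refine lt_of_mul_lt_mul_left ?_ hξ.le
    linarith
  have hX₁1 : X₁ < 1 := by
    refine lt_of_mul_lt_mul_left ?_ hξ.le
    linarith
  have s1 := d1 (pt (0 : ℤ) (1 : ℤ)) (pt (1 : ℤ) (0 : ℤ))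
    (isEdge_pt (by decide) (by decide) (by norm_num))
    (mem_openSegment_of_coord X₁ hX₁0 hX₁1 (by simp [hX₁]) (by simp [cy1]))
  obtain ⟨ux1, uy1⟩ := refract_coord (e := pt (1 : ℤ) (0 : ℤ) - pt (0 : ℤ) (1 : ℤ)) u
    (by simp)
  rw [← s1] at ux1 uy1
  replace ux1 : xCoord (x t₁).2 = η := by
    rw [ux1]; simp; ring
  replace uy1 : yCoord (x t₁).2 = ξ := by
    rw [uy1]; simp; ring
  -- the second crossing, at the point `(1 - p / ξ, 1)`
  have hδ₂ : 0 < X₁ / ξ := div_pos hX₁0 hξ0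
  have h2 : ∀ r ∈ Ioo 0 (X₁ / ξ), (x t₁).1 + r • ((x t₁).2 : ℂ) ∈ upperTriangle := by
    rintro r ⟨hr0, hr⟩
    rw [lt_div_iff₀ hξ0] at hr
    simp only [upperTriangle, mem_ofPred_eq, map_add, map_smul, smul_eq_mul, cy1, ux1, uy1, ← hX₁]
    have h1 : r * η ≤ 0 := mul_nonpos_of_nonneg_of_nonpos hr0.le hη
    have h3 : 0 < r * (ξ + η) := by positivity
    refine ⟨?_, ?_, ?_⟩ <;> linarith
  obtain ⟨c2, d2⟩ := hx.cross hδ₂ fun r hr => inTile_of_mem_upperTriangle (h2 r hr)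
  set t₂ := t₁ + X₁ / ξ with ht₂
  have cx2 : xCoord (x t₂).1 = 1 - p / ξ := by
    rw [c2]
    simp only [map_add, map_smul, smul_eq_mul, ← hX₁, ux1]
    field_simp; linarith
  have cy2 : yCoord (x t₂).1 = 1 := by
    rw [c2]
    simp only [map_add, map_smul, smul_eq_mul, cy1, uy1]
    field_simp; ring
  have hq0 : 0 < p / ξ := div_pos (by linarith) hξ0
  have hq1 : p / ξ < 1 := by rwa [div_lt_one hξ0]
  have s2 := d2 (pt (0 : ℤ) (1 : ℤ)) (pt (1 : ℤ) (1 : ℤ))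
    (isEdge_pt (by decide) (by decide) (by norm_num))
    (mem_openSegment_of_coord (1 - p / ξ) (by linarith) (by linarith)
      (by simp [cx2]) (by simp [cy2]))
  obtain ⟨ux2, uy2⟩ := refract_coord (e := pt (1 : ℤ) (1 : ℤ) - pt (0 : ℤ) (1 : ℤ))
    (x t₁).2 (by simp)
  rw [← s2] at ux2 uy2
  replace ux2 : xCoord (x t₂).2 = -ξ - η := by
    rw [ux2, ux1, uy1]; simp; ring
  replace uy2 : yCoord (x t₂).2 = ξ := by
    rw [uy2, ux1, uy1]; simp
  have hdir : ((x t₂).2 : ℂ) = (zeta : ℂ) ^ 2 * u := by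
    apply coord_ext
    · rw [ux2, (coord_zeta_pow_two u).1]
    · rw [uy2, (coord_zeta_pow_two u).2]
  have hoff2 : offset (x t₂).2 ((x t₂).1 - 2 * pt 0 1) = p + η := by
    simp only [offset, ux2, uy2, map_sub, two_mul_pt, xCoord_pt, yCoord_pt, cx2, cy2]
    field_simp; ring
  have h3 : ∀ᶠ s in 𝓝[>] t₂, (straight (x t₂) t₂ s).1 ∈ hexInt (2 * pt 0 1) := by
    filter_upwards [eventually_lt_add_mul (-ξ - η) t₂ (show -1 < 1 - p / ξ by linarith),
      eventually_add_mul_lt (ξ) t₂ (show (-1 : ℝ) < 1 by norm_num),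
      eventually_lt_add_mul (-η) t₂ (show -1 < -(p / ξ) by linarith),
      eventually_lt_add_mul η t₂ (show -1 < -(p / ξ) by linarith),
      eventually_add_mul_lt (-η) t₂ (show -(p / ξ) < 1 by linarith), self_mem_nhdsWithin]
      with s e1 e2 e3 e4 e5 hs
    have hs' : 0 < s - t₂ := sub_pos.2 hs
    have k1 : 0 < (s - t₂) * ξ := by positivity
    have k3 : 0 < (s - t₂) * (ξ + η) := by positivity
    rw [mem_hexInt_iff_sub, mem_hexInt_zero]
    simp only [straight, map_sub, map_add, map_smul, smul_eq_mul, two_mul_pt, xCoord_pt,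
      yCoord_pt, cx2, cy2, ux2, uy2]
    refine ⟨⟨?_, ?_⟩, ⟨?_, ?_⟩, ⟨?_, ?_⟩⟩ <;> linarith
  have := hx.next_passage (fun z => inTile_of_mem_upperTriangle)
    (fun z hz c hc => upperTriangle_notMem_hexInt hc hz) hδ₁ hδ₂ hz h1
    (fun c hc => notMem_hexInt_of_add hc (by rw [cy1, ← hX₁]; ring)) h2
    (fun c hc => notMem_hexInt_of_yCoord hc cy2) h3
  rw [hoff2, hdir, ← hu, hoff'] at this
  exact this

/-- A passage with the offset of the corner `(1, 0)` would run into this corner. -/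
theorem offset_ne (hx : IsTrajectory x) {t p : ℝ} {u : ℂ} (h : Passage x t 0 u p)
    (hη : yCoord u ≤ 0) (hξ : 0 < xCoord u + yCoord u) : p ≠ -yCoord u := by
  intro hp
  obtain ⟨hz, rfl, hoff⟩ := h
  rw [mul_zero] at hz hoff
  rw [sub_zero] at hoff
  obtain ⟨δ, hδ, h1, cx1, cy1⟩ :=
    exit_right hz hη hξ (by rw [hoff, hp]; linarith) (hoff.trans hp).le
  obtain ⟨c1, -⟩ := hx.cross hδ fun r hr => inTile_of_mem_hexInt_zero (h1 r hr)
  refine hx.notMem_vertices (t + δ) ?_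
  rw [hoff, hp, neg_add_cancel, mul_eq_zero] at cy1
  replace cy1 := cy1.resolve_left (by linarith)
  rw [← c1] at cx1 cy1
  rw [← pt_coord (x (t + δ)).1, cx1, cy1]
  simpa using pt_mem_vertices (m := 1) (n := 0) (by decide)

end IsTrajectory

/-! ### The rotation of the offsets -/

/-- The offsets of the successive passages through hexagons: the orbit of `p` under the rotation
by `-b` of the circle `ℝ / aℤ`, with `(0, a)` as fundamental domain. -/
def offsetSeq (a b p : ℝ) : ℕ → ℝ
  | 0 => p
  | n + 1 => if offsetSeq a b p n < b then offsetSeq a b p n + (a - b) else offsetSeq a b p n - b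

/-- Half the centres of the successive hexagons: the trajectory turns around a vertex of the
`n`-th hexagon, and the vertex is determined by the offset. -/
def centreSeq (a b p : ℝ) : ℕ → ℂ
  | 0 => 0
  | n + 1 => centreSeq a b p n +
      (zeta : ℂ) ^ (2 * n) * (if offsetSeq a b p n < b then pt 1 0 else pt 0 1)

/-- The indicator of the event that the rotation of the offsets passes through zero. -/
def wrap (a b p : ℝ) (n : ℕ) : ℤ := if offsetSeq a b p n < b then 1 else 0

theorem offsetSeq_eq (a b p : ℝ) (n : ℕ) :
    offsetSeq a b p n = p - n * b + a * (∑ i ∈ Finset.range n, wrap a b p i : ℤ) := by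
  induction n with
  | zero => simp [offsetSeq]
  | succ n ih =>
    rw [offsetSeq, Finset.sum_range_succ]
    split_ifs with h <;> rw [ih] <;> simp only [wrap, h, if_true, if_false] <;> push_cast <;> ring

theorem centreSeq_eq (a b p : ℝ) (n : ℕ) :
    centreSeq a b p n = zeta * ∑ i ∈ Finset.range n, ((zeta : ℂ) ^ 2) ^ i +
      (1 - zeta) * ∑ i ∈ Finset.range n, wrap a b p i * ((zeta : ℂ) ^ 2) ^ i := by
  induction n with
  | zero => simp [centreSeq]
  | succ n ih =>
    rw [centreSeq, Finset.sum_range_succ, Finset.sum_range_succ, ih, pow_mul]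
    split_ifs with h <;> simp only [wrap, h, if_true, if_false, pt] <;> push_cast <;> ring

theorem offsetSeq_add {a b p : ℝ} {n : ℕ} (h : offsetSeq a b p n = p) (i : ℕ) :
    offsetSeq a b p (n + i) = offsetSeq a b p i := by
  induction i with
  | zero => exact h
  | succ i ih => rw [← add_assoc, offsetSeq, ih, offsetSeq]

theorem zeta_sq_pow_three : ((zeta : ℂ) ^ 2) ^ 3 = 1 := by
  rw [← pow_mul, mul_comm, pow_mul, zeta_pow_three]; norm_num

theorem zeta_sq_eq : (zeta : ℂ) ^ 2 = pt (-1) 1 := by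
  rw [← mul_one ((zeta : ℂ) ^ 2)]
  have h1 : (1 : ℂ) = pt 1 0 := by simp [pt]
  apply coord_ext
  · rw [(coord_zeta_pow_two _).1, h1]; simp
  · rw [(coord_zeta_pow_two _).2, h1]; simp

theorem zeta_sq_ne_one : (zeta : ℂ) ^ 2 ≠ 1 := by
  intro h
  have h1 : (1 : ℂ) = pt 1 0 := by simp [pt]
  rw [zeta_sq_eq, h1] at h
  simpa using congrArg yCoord h

theorem sum_zeta_sq_pow {n : ℕ} (h : 3 ∣ n) :
    ∑ i ∈ Finset.range n, ((zeta : ℂ) ^ 2) ^ i = 0 := by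
  obtain ⟨k, rfl⟩ := h
  rw [geom_sum_eq zeta_sq_ne_one, pow_mul, zeta_sq_pow_three]
  simp

/-- The functional `X + 2 Y` modulo three is the reduction of the Eisenstein integers modulo the
prime above three, and it maps the cube roots of unity to one. -/
theorem zeta_sq_pow_coord (i : ℕ) : ∃ k : ℤ,
    xCoord (((zeta : ℂ) ^ 2) ^ i) + 2 * yCoord (((zeta : ℂ) ^ 2) ^ i) = 1 + 3 * k := by
  suffices h : ∃ m n k : ℤ, ((zeta : ℂ) ^ 2) ^ i = pt m n ∧ m + 2 * n = 1 + 3 * k by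
    obtain ⟨m, n, k, h1, h2⟩ := h
    refine ⟨k, ?_⟩
    rw [h1, xCoord_pt, yCoord_pt]
    exact_mod_cast h2
  induction i with
  | zero => exact ⟨1, 0, 0, by simp [pt], by norm_num⟩
  | succ i ih =>
    obtain ⟨m, n, k, h1, h2⟩ := ih
    refine ⟨-m - n, m, k - n, ?_, by linarith⟩
    rw [pow_succ', h1]
    apply coord_ext
    · rw [(coord_zeta_pow_two _).1]; simp
    · rw [(coord_zeta_pow_two _).2]; simp

/-- If a combination of powers of a primitive cube root of unity with integer coefficients
vanishes, then three divides the sum of the coefficients. -/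
theorem three_dvd_sum_of_sum_eq_zero {n : ℕ} {c : ℕ → ℤ}
    (h : ∑ i ∈ Finset.range n, (c i : ℂ) * ((zeta : ℂ) ^ 2) ^ i = 0) :
    3 ∣ ∑ i ∈ Finset.range n, c i := by
  choose k hk using zeta_sq_pow_coord
  have h1 : ∀ i, xCoord ((c i : ℂ) * ((zeta : ℂ) ^ 2) ^ i) +
      2 * yCoord ((c i : ℂ) * ((zeta : ℂ) ^ 2) ^ i) = (c i * (1 + 3 * k i) : ℤ) := by
    intro i
    have h2 : (c i : ℂ) * ((zeta : ℂ) ^ 2) ^ i = (c i : ℝ) • ((zeta : ℂ) ^ 2) ^ i := by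
      rw [Complex.real_smul]; simp
    rw [h2, map_smul, map_smul, smul_eq_mul, smul_eq_mul]
    push_cast
    rw [← hk]; ring
  have h3 : ((∑ i ∈ Finset.range n, c i * (1 + 3 * k i) : ℤ) : ℝ) = 0 := by
    rw [Int.cast_sum, ← Finset.sum_congr rfl fun i _ => h1 i, Finset.sum_add_distrib,
      ← Finset.mul_sum, ← map_sum, ← map_sum, h]
    simp
  have h4 : ∑ i ∈ Finset.range n, c i * (1 + 3 * k i) = 0 := by exact_mod_cast h3
  refine ⟨-∑ i ∈ Finset.range n, c i * k i, ?_⟩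
  have h5 : ∑ i ∈ Finset.range n, c i * (1 + 3 * k i) =
      ∑ i ∈ Finset.range n, c i + 3 * ∑ i ∈ Finset.range n, c i * k i := by
    rw [Finset.mul_sum, ← Finset.sum_add_distrib]
    exact Finset.sum_congr rfl fun i _ => by ring
  linarith

/-- The arithmetic reason for the symmetry of order three: if the hexagon and the offset recur,
then the offset recurs after a number of passages that is not divisible by three. If three divides
the number `N` of passages then, since the displacement vanishes, three divides the number of
turns of the rotation as well, and the offset recurs after `N / 3` passages. -/
theorem exists_not_three_dvd {a b p : ℝ} (hpos : ∀ n, 0 < offsetSeq a b p n)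
    (hlt : ∀ n, offsetSeq a b p n < a) {N : ℕ} (hN : 0 < N) (hoff : offsetSeq a b p N = p)
    (hcen : centreSeq a b p N = 0) : ∃ n, ¬3 ∣ n ∧ offsetSeq a b p n = p := by
  by_contra! hcon
  have ha : 0 < a := (hpos 0).trans (hlt 0)
  have h3 : ∀ n, offsetSeq a b p n = p → 3 ∣ n := fun n hn => by
    by_contra h
    exact hcon n h hn
  have h1ζ : (1 : ℂ) - zeta ≠ 0 := by
    intro h
    refine zeta_sq_ne_one ?_
    rw [← sub_eq_zero.1 h]; simp
  suffices key : ∀ N : ℕ, 0 < N → offsetSeq a b p N = p →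
      ∑ i ∈ Finset.range N, (wrap a b p i : ℂ) * ((zeta : ℂ) ^ 2) ^ i ≠ 0 by
    rw [centreSeq_eq, sum_zeta_sq_pow (h3 N hoff), mul_zero, zero_add, mul_eq_zero] at hcen
    exact key N hN hoff (hcen.resolve_left h1ζ)
  intro N
  induction N using Nat.strong_induction_on with
  | _ N ih =>
    intro hN hoff hsum
    obtain ⟨n, rfl⟩ := h3 N hoff
    obtain ⟨M, hM⟩ := three_dvd_sum_of_sum_eq_zero hsum
    -- `3 n b = 3 M a`, so `n` steps change the offset by a multiple of `a`
    have hn : offsetSeq a b p n = p := by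
      have e1 := offsetSeq_eq a b p (3 * n)
      have e2 := offsetSeq_eq a b p n
      rw [hM, hoff] at e1
      push_cast at e1
      set S : ℤ := ∑ i ∈ Finset.range n, wrap a b p i
      have e3 : offsetSeq a b p n = p + a * (S - M : ℤ) := by
        rw [e2]; push_cast; linarith
      have e4 : (S - M : ℤ) < (1 : ℝ) := by
        by_contra! h
        have := mul_le_mul_of_nonneg_left h ha.le
        have h5 := hlt n
        have h6 : 0 < p := hpos 0
        linarith
      have e5 : (-1 : ℝ) < (S - M : ℤ) := by
        by_contra! h
        have := mul_le_mul_of_nonneg_left h ha.le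
        have h5 := hpos n
        have h6 : p < a := hlt 0
        linarith
      have e6 : S - M < 1 := by exact_mod_cast e4
      have e7 : -1 < S - M := by exact_mod_cast e5
      have e8 : S - M = 0 := by omega
      rw [e3, e8]; simp
    refine ih n (by omega) (by omega) hn ?_
    have hω : ((zeta : ℂ) ^ 2) ^ n = 1 := by
      obtain ⟨k, rfl⟩ := h3 n hn
      rw [pow_mul, zeta_sq_pow_three, one_pow]
    have hshift : ∀ i, (wrap a b p (n + i) : ℂ) * ((zeta : ℂ) ^ 2) ^ (n + i) =
        wrap a b p i * ((zeta : ℂ) ^ 2) ^ i := by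
      intro i
      rw [wrap, offsetSeq_add hn, ← wrap, pow_add, hω, one_mul]
    have hblock : ∑ i ∈ Finset.range (3 * n), (wrap a b p i : ℂ) * ((zeta : ℂ) ^ 2) ^ i =
        3 * ∑ i ∈ Finset.range n, (wrap a b p i : ℂ) * ((zeta : ℂ) ^ 2) ^ i := by
      rw [show 3 * n = n + (n + n) by ring, Finset.sum_range_add, Finset.sum_congr rfl
        fun i _ => hshift i, Finset.sum_range_add, Finset.sum_congr rfl fun i _ => hshift i]
      ring
    rw [hblock, mul_eq_zero] at hsum
    exact hsum.resolve_left (by norm_num)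

/-! ### The sequence of passages of a trajectory -/

/-- The symmetry `z ↦ 2 l + zeta ^ k z` of the tiling. -/
def tilingMap (k : ℕ) (l : ℂ) : ℂ ≃ᵃⁱ[ℝ] ℂ := isometryOf (_root_.rotation (zeta ^ k)) (2 * l)

theorem tilingMap_apply (k : ℕ) (l z : ℂ) : tilingMap k l z = 2 * l + (zeta : ℂ) ^ k * z := by
  simp only [tilingMap, isometryOf_apply, rotation_apply, Circle.coe_pow]

theorem tilingMap_linear (k : ℕ) (l u : ℂ) :
    (tilingMap k l).linearIsometryEquiv u = (zeta : ℂ) ^ k * u := by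
  simp only [tilingMap, isometryOf_linear, rotation_apply, Circle.coe_pow]

/-- Symmetries of the tiling preserve the offsets of passages. -/
theorem passage_tilingMap_iff {y : ℝ → UnitTangentBundle} {s p : ℝ} {c u l : ℂ} {k : ℕ} :
    Passage (fun t => tangentMap (tilingMap k l) (y t)) s (l + (zeta : ℂ) ^ k * c)
      ((zeta : ℂ) ^ k * u) p ↔ Passage y s c u p := by
  have h0 : (zeta : ℂ) ^ k ≠ 0 := pow_ne_zero _ (Circle.coe_ne_zero _)
  have h1 : 2 * l + (zeta : ℂ) ^ k * (y s).1 - 2 * (l + (zeta : ℂ) ^ k * c) =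
      (zeta : ℂ) ^ k * ((y s).1 - 2 * c) := by ring
  simp only [Passage, tangentMap_fst, coe_tangentMap_snd, tilingMap_apply, tilingMap_linear]
  rw [mem_hexInt_iff_sub, h1, zeta_pow_mul_mem_hexInt_iff, offset_zeta_pow_mul,
    mul_right_inj' h0, ← mem_hexInt_iff_sub]

theorem Passage.offset_lt {x : ℝ → UnitTangentBundle} {t p : ℝ} {u : ℂ} (h : Passage x t 0 u p) (hη : yCoord u ≤ 0)
    (hξ : 0 < xCoord u + yCoord u) : p < xCoord u := by
  obtain ⟨hz, -, rfl⟩ := h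
  rw [mul_zero] at hz ⊢
  obtain ⟨-, ⟨-, hY⟩, -, hS⟩ := mem_hexInt_zero.1 hz
  have h1 := mul_lt_mul_of_pos_left hY hξ
  have h2 := mul_le_mul_of_nonpos_left hS.le hη
  rw [sub_zero, offset]
  linarith

namespace IsTrajectory

variable {x : ℝ → UnitTangentBundle}

/-- The passage through the next hexagon, for a passage in general position. -/
theorem exists_next (hx : IsTrajectory x) {t p : ℝ} {u l : ℂ} {k : ℕ}
    (hl : l ∈ eisensteinLattice) (h : Passage x t l ((zeta : ℂ) ^ k * u) p)
    (hη : yCoord u ≤ 0) (hξ : 0 < xCoord u + yCoord u) (hp : 0 ≤ p) :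
    (0 < p ∧ p < xCoord u ∧ p ≠ -yCoord u) ∧
    let V := if p < -yCoord u then pt 1 0 else pt 0 1
    let p' := if p < -yCoord u then p + (xCoord u - -yCoord u) else p - -yCoord u
    ∃ t' > t, Passage x t' (l + (zeta : ℂ) ^ k * V) ((zeta : ℂ) ^ (k + 2) * u) p' ∧
      ∀ s ∈ Icc t t', ∀ c ∈ eisensteinLattice, (x s).1 ∈ hexInt (2 * c) →
        Passage x s l ((zeta : ℂ) ^ k * u) p ∨
        Passage x s (l + (zeta : ℂ) ^ k * V) ((zeta : ℂ) ^ (k + 2) * u) p' := by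
  have hf : IsTilingSymmetry (tilingMap k l) := isTilingSymmetry_rotation k hl
  set y : ℝ → UnitTangentBundle := fun t => tangentMap (tilingMap k l).symm (x t) with hyd
  have hy : IsTrajectory y := hf.symm.isTrajectory hx
  have hxy : x = fun t => tangentMap (tilingMap k l) (y t) := by
    funext t
    rw [hyd, tangentMap_apply_symm]
  have hl0 : l = l + (zeta : ℂ) ^ k * 0 := by simp
  have tr : ∀ s c v q, Passage y s c v q →
      Passage x s (l + (zeta : ℂ) ^ k * c) ((zeta : ℂ) ^ k * v) q := fun s c v q hq => by
    rw [hxy]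
    exact passage_tilingMap_iff.2 hq
  have h' : Passage y t 0 u p := by
    rw [hl0, hxy] at h
    exact passage_tilingMap_iff.1 h
  have hne := hy.offset_ne h' hη hξ
  have hmem : ∀ s, ∀ c ∈ eisensteinLattice, (x s).1 ∈ hexInt (2 * c) →
      ∃ c' ∈ eisensteinLattice, (y s).1 ∈ hexInt (2 * c') := by
    intro s c hc hs
    refine ⟨(zeta : ℂ) ^ (5 * k) * (c - l), zeta_pow_mul_mem_lattice _ (sub_mem hc hl), ?_⟩
    rw [mem_hexInt_iff_sub, ← zeta_pow_mul_mem_hexInt_iff k]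
    rw [mem_hexInt_iff_sub, hxy] at hs
    simp only [tangentMap_fst, tilingMap_apply] at hs
    have h6 : (zeta : ℂ) ^ k * (zeta : ℂ) ^ (5 * k) = 1 := by
      rw [← pow_add, show k + 5 * k = 6 * k by ring, pow_mul]
      rw [coe_zeta_pow_six, one_pow]
    convert hs using 1
    linear_combination (-2 * (c - l)) * h6
  rcases lt_or_ge p (-yCoord u) with hlt | hge
  · obtain ⟨hp0, t', ht', h1, h2⟩ := hy.next_passage_lower h' hη hξ hp hlt
    refine ⟨⟨hp0, h'.offset_lt hη hξ, hne⟩, ?_⟩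
    simp only [hlt, if_true, sub_neg_eq_add, pow_add, mul_assoc]
    refine ⟨t', ht', tr _ _ _ _ h1, fun s hs c hc hsc => ?_⟩
    obtain ⟨c', hc', hsc'⟩ := hmem s c hc hsc
    refine (h2 s hs c' hc' hsc').imp (fun h => ?_) (tr _ _ _ _)
    simpa using tr _ _ _ _ h
  · have hgt : -yCoord u < p := lt_of_le_of_ne hge hne.symm
    obtain ⟨t', ht', h1, h2⟩ := hy.next_passage_upper h' hη hξ hgt
    refine ⟨⟨by linarith, h'.offset_lt hη hξ, hne⟩, ?_⟩
    simp only [hge.not_gt, if_false, sub_neg_eq_add, pow_add, mul_assoc]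
    refine ⟨t', ht', tr _ _ _ _ h1, fun s hs c hc hsc => ?_⟩
    obtain ⟨c', hc', hsc'⟩ := hmem s c hc hsc
    refine (h2 s hs c' hc' hsc').imp (fun h => ?_) (tr _ _ _ _)
    simpa using tr _ _ _ _ h

end IsTrajectory

theorem centreSeq_mem (a b p : ℝ) (n : ℕ) : centreSeq a b p n ∈ eisensteinLattice := by
  induction n with
  | zero => exact zero_mem _
  | succ n ih =>
    refine add_mem ih (zeta_pow_mul_mem_lattice _ ?_)
    split_ifs
    · simpa using pt_mem_lattice 1 0
    · simpa using pt_mem_lattice 0 1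

/-- The data of the `n`-th passage of a trajectory that starts in the hexagon with centre zero. -/
def NthPassage (x : ℝ → UnitTangentBundle) (u : ℂ) (p : ℝ) (n : ℕ) (s : ℝ) : Prop :=
  Passage x s (centreSeq (xCoord u) (-yCoord u) p n) ((zeta : ℂ) ^ (2 * n) * u)
    (offsetSeq (xCoord u) (-yCoord u) p n)

/-- From the time `t` on, all passages of a trajectory are described by the rotation of the
offsets. -/
theorem IsTrajectory.exists_passages {x : ℝ → UnitTangentBundle} (hx : IsTrajectory x) {t p : ℝ}
    {u : ℂ} (h : Passage x t 0 u p) (hη : yCoord u ≤ 0) (hξ : 0 < xCoord u + yCoord u)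
    (hp : 0 ≤ p) :
    (∀ n, 0 < offsetSeq (xCoord u) (-yCoord u) p n ∧
      offsetSeq (xCoord u) (-yCoord u) p n < xCoord u) ∧
    ∃ T : ℕ → ℝ, T 0 = t ∧ (∀ n, NthPassage x u p n (T n)) ∧
      ∀ m s, T m ≤ s → ∀ c ∈ eisensteinLattice, (x s).1 ∈ hexInt (2 * c) →
        ∃ n, m ≤ n ∧ c = centreSeq (xCoord u) (-yCoord u) p n ∧ NthPassage x u p n s := by
  have hstep : ∀ (n : ℕ) (s : {s : ℝ // NthPassage x u p n s ∧
      0 ≤ offsetSeq (xCoord u) (-yCoord u) p n}), ∃ s' : {s : ℝ // NthPassage x u p (n + 1) s ∧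
      0 ≤ offsetSeq (xCoord u) (-yCoord u) p (n + 1)}, s.1 < s'.1 ∧
      ∀ r ∈ Icc s.1 s'.1, ∀ c ∈ eisensteinLattice, (x r).1 ∈ hexInt (2 * c) →
        NthPassage x u p n r ∨ NthPassage x u p (n + 1) r := by
    rintro n ⟨s, hs, hs0⟩
    obtain ⟨⟨h1, h2, h3⟩, t', ht', h4, h5⟩ := hx.exists_next (centreSeq_mem _ _ _ n) hs hη hξ hs0
    refine ⟨⟨t', h4, ?_⟩, ht', h5⟩
    rw [offsetSeq]
    split_ifs with hlt
    · linarith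
    · have := lt_of_le_of_ne (not_lt.1 hlt) h3.symm
      linarith
  choose next hnext hnext' using hstep
  let S : (n : ℕ) → {s : ℝ // NthPassage x u p n s ∧
      0 ≤ offsetSeq (xCoord u) (-yCoord u) p n} :=
    fun n => Nat.rec ⟨t, by simpa [NthPassage, centreSeq, offsetSeq] using h, hp⟩ next n
  have hmono : StrictMono fun n => (S n).1 := strictMono_nat_of_lt_succ fun n => hnext n (S n)
  refine ⟨fun n => ?_, fun n => (S n).1, rfl, fun n => (S n).2.1, ?_⟩
  · have := (hx.exists_next (centreSeq_mem _ _ _ n) (S n).2.1 hη hξ (S n).2.2).1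
    exact ⟨this.1, this.2.1⟩
  -- The passages do not accumulate, since the direction is constant before any given time.
  have hunb : ∀ s, ∃ n, s < (S n).1 := by
    by_contra! hcon
    obtain ⟨s, hs⟩ := hcon
    have hbdd : BddAbove (range fun n => (S n).1) := ⟨s, by rintro _ ⟨n, rfl⟩; exact hs n⟩
    have hlim := tendsto_atTop_ciSup hmono.monotone hbdd
    set L := ⨆ n, (S n).1
    have hltL : ∀ n, (S n).1 < L := fun n =>
      (hmono n.lt_succ_self).trans_le (le_ciSup hbdd (n + 1))
    have hlim' : Tendsto (fun n => (S n).1) atTop (𝓝[<] L) :=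
      tendsto_nhdsWithin_iff.2 ⟨hlim, Eventually.of_forall hltL⟩
    obtain ⟨d, hd, -, -⟩ := hx.germ_left L
    obtain ⟨N, hN⟩ := eventually_atTop.1 (hlim'.eventually hd)
    have e1 : (d : ℂ) = (zeta : ℂ) ^ (2 * N) * u := by
      rw [← (S N).2.1.2.1, hN N le_rfl]; rfl
    have e2 : (d : ℂ) = (zeta : ℂ) ^ (2 * (N + 1)) * u := by
      rw [← (S (N + 1)).2.1.2.1, hN (N + 1) (by omega)]; rfl
    have hd0 := Circle.coe_ne_zero d
    refine zeta_sq_ne_one (mul_right_cancel₀ hd0 ?_)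
    rw [one_mul]
    nth_rw 1 [e1]
    rw [e2]; ring
  intro m s hms c hc hsc
  have hex := hunb s
  classical
  obtain ⟨n, hn⟩ : ∃ n, Nat.find hex = n + 1 := by
    refine Nat.exists_eq_succ_of_ne_zero fun h0 => ?_
    have := Nat.find_spec hex
    rw [h0] at this
    exact absurd (hmono.monotone (Nat.zero_le m)) (by simpa using hms.trans_lt this)
  have h1 : s < (S (n + 1)).1 := hn ▸ Nat.find_spec hex
  have h2 : (S n).1 ≤ s := not_lt.1 (Nat.find_min hex (by omega))
  have hmn : m ≤ n := by
    by_contra! hlt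
    exact absurd (hmono.monotone (show n + 1 ≤ m from hlt)) (by simpa using hms.trans_lt h1)
  rcases hnext' n (S n) s ⟨h2, h1.le⟩ c hc hsc with h | h
  · exact ⟨n, hmn, hexInt_unique hc (centreSeq_mem _ _ _ _) hsc h.1, h⟩
  · exact ⟨n + 1, by omega, hexInt_unique hc (centreSeq_mem _ _ _ _) hsc h.1, h⟩

/-! ### The symmetry of order three -/

theorem convex_hexInt_zero : Convex ℝ (hexInt 0) := by
  have h : hexInt 0 = xCoord ⁻¹' Ioo (-1) 1 ∩ (yCoord ⁻¹' Ioo (-1) 1 ∩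
      (xCoord + yCoord) ⁻¹' Ioo (-1) 1) := by
    ext z
    exact mem_hexInt_zero
  rw [h]
  exact ((convex_Ioo _ _).linear_preimage _).inter
    (((convex_Ioo _ _).linear_preimage _).inter ((convex_Ioo _ _).linear_preimage _))

namespace IsTrajectory

variable {x y : ℝ → UnitTangentBundle}

/-- A trajectory in a hexagon reaches each point of the hexagon straight ahead. -/
theorem eq_of_collinear (hx : IsTrajectory x) {t t' r : ℝ} (hr : 0 < r)
    (hz : (x t).1 ∈ hexInt 0) (hz' : (y t').1 ∈ hexInt 0)
    (h1 : (y t').1 = (x t).1 + r • ((x t).2 : ℂ)) (h2 : (y t').2 = (x t).2) :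
    x (t + r) = y t' := by
  have hin : ∀ q ∈ Ioo 0 r, InTile ((x t).1 + q • ((x t).2 : ℂ)) := by
    rintro q ⟨hq0, hqr⟩
    refine inTile_of_mem_hexInt_zero ?_
    have := convex_hexInt_zero hz hz' (a := 1 - q / r) (b := q / r)
      (by rw [sub_nonneg, div_le_one hr]; exact hqr.le) (by positivity) (by ring)
    rw [h1, smul_add, ← add_assoc, ← add_smul, smul_smul, div_mul_cancel₀ _ hr.ne'] at this
    simpa using this
  obtain ⟨h3, h4, -⟩ := hx.left_limit (by linarith) (hx.run hin)
  rw [add_sub_cancel_left, ← h1] at h3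
  exact Prod.ext h3 ((h4 (h3 ▸ inTile_of_mem_hexInt_zero hz')).trans h2.symm)

/-- Two trajectories that pass the same hexagon on the same line have a common point. -/
theorem exists_eq (hx : IsTrajectory x) (hy : IsTrajectory y) {t t' p : ℝ} {u : ℂ}
    (h : Passage x t 0 u p) (h' : Passage y t' 0 u p) (hu : xCoord u ≠ 0) :
    ∃ s s', x s = y s' := by
  obtain ⟨hz, hu1, hp⟩ := h
  obtain ⟨hz', hu2, hp'⟩ := h'
  rw [mul_zero] at hz hz' hp hp'
  rw [sub_zero] at hp hp'
  have hdir : (y t').2 = (x t).2 := Circle.ext (hu2.trans hu1.symm)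
  set r := (xCoord (y t').1 - xCoord (x t).1) / xCoord u with hr
  have hline : (y t').1 = (x t).1 + r • u := by
    have h1 : r * xCoord u = xCoord (y t').1 - xCoord (x t).1 := by rw [hr]; field_simp
    apply coord_ext
    · rw [map_add, map_smul, smul_eq_mul, h1]; ring
    · rw [map_add, map_smul, smul_eq_mul]
      rw [offset] at hp hp'
      refine mul_left_cancel₀ hu ?_
      linear_combination hp' - hp - yCoord u * h1
  rcases lt_trichotomy r 0 with h0 | h0 | h0
  · refine ⟨t, t' + -r, (hy.eq_of_collinear (by linarith) hz' hz ?_ hdir.symm).symm⟩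
    rw [hu2, hline, neg_smul]; abel
  · exact ⟨t, t', Prod.ext (by rw [hline, h0, zero_smul, add_zero]) hdir.symm⟩
  · exact ⟨t + r, t', hx.eq_of_collinear h0 hz hz' (by rw [hu1, hline]) hdir⟩

end IsTrajectory

theorem exists_ge_eq {x : ℝ → UnitTangentBundle} {τ : ℝ} (hτ : 0 < τ)
    (hper : Function.Periodic x τ) (a b : ℝ) : ∃ s, b ≤ s ∧ x s = x a := by
  obtain ⟨n, hn⟩ := exists_nat_ge ((b - a) / τ)
  refine ⟨a + n * τ, ?_, hper.nat_mul n a⟩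
  rw [div_le_iff₀ hτ] at hn
  linarith

/-- A symmetry that maps one point of a periodic trajectory into the trajectory maps the
trajectory onto itself. -/
theorem image_orbit_eq {x : ℝ → UnitTangentBundle} (hx : IsTrajectory x) {τ : ℝ} (hτ : 0 < τ)
    (hper : Function.Periodic x τ) {f : ℂ ≃ᵃⁱ[ℝ] ℂ} (hf : IsTilingSymmetry f) {s s' : ℝ}
    (h : tangentMap f (x s) = x s') : tangentMap f '' orbit x = orbit x := by
  have key : ∀ r, 0 ≤ r → tangentMap f (x (r + s)) = x (r + s') := fun r hr =>
    (hf.isTrajectory (hx.comp_add s)).forward_unique (hx.comp_add s') (t := 0)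
      (by simpa using h) hr
  refine Subset.antisymm ?_ ?_
  · rintro _ ⟨_, ⟨a, rfl⟩, rfl⟩
    obtain ⟨b, hb, hab⟩ := exists_ge_eq hτ hper a s
    refine ⟨b - s + s', ?_⟩
    rw [← key (b - s) (by linarith), sub_add_cancel, hab]
  · rintro _ ⟨a, rfl⟩
    obtain ⟨b, hb, hab⟩ := exists_ge_eq hτ hper a s'
    refine ⟨x (b - s' + s), ⟨_, rfl⟩, ?_⟩
    rw [key _ (by linarith), sub_add_cancel, hab]

theorem orderOf_zeta_pow {n : ℕ} (h : ¬3 ∣ n) : orderOf (zeta ^ (2 * n)) = 3 := by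
  have h3 : (zeta ^ 2) ^ 3 = 1 := by rw [← pow_mul, zeta_pow_six]
  have h1 : zeta ^ 2 ≠ 1 := fun h => zeta_sq_ne_one (by exact_mod_cast congrArg Subtype.val h)
  have h2 : orderOf (zeta ^ 2) = 3 := orderOf_eq_prime h3 h1
  rw [pow_mul, Nat.Coprime.orderOf_pow, h2]
  rw [h2]
  exact (Nat.prime_three.coprime_iff_not_dvd).2 h

theorem path_eq (x : ℝ → UnitTangentBundle) : path x = Prod.fst '' orbit x := by
  rw [path, orbit, ← range_comp]; rfl

theorem image_path_of_image_orbit {x : ℝ → UnitTangentBundle} {c : ℂ} {ω : Circle}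
    (h : rotationOnTangent c ω '' orbit x = orbit x) : rotation c ω '' path x = path x := by
  conv_rhs => rw [path_eq, ← h]
  rw [path_eq, ← image_comp, ← image_comp]
  rfl

theorem rotation_eq_tilingMap {k : ℕ} {l c : ℂ} (hc : rotation c (zeta ^ k) 0 = 2 * l) :
    rotation c (zeta ^ k) = tilingMap k l := by
  funext z
  rw [tilingMap_apply, ← hc]
  simp only [rotation, Circle.coe_pow]; ring

theorem rotationOnTangent_eq_tangentMap {k : ℕ} {l c : ℂ}
    (hc : rotation c (zeta ^ k) 0 = 2 * l) :
    rotationOnTangent c (zeta ^ k) = tangentMap (tilingMap k l) := by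
  funext z
  refine Prod.ext ?_ (Circle.ext ?_)
  · rw [rotationOnTangent, rotation_eq_tilingMap hc]; rfl
  · simp [rotationOnTangent, tilingMap_linear]

/-- The symmetry of order three of a periodic trajectory, given a passage in normalised position. -/
theorem exists_threefold {x : ℝ → UnitTangentBundle} (hx : IsPeriodicTrajectory x) {t p : ℝ}
    {u : ℂ} (h : Passage x t 0 u p) (hη : yCoord u ≤ 0) (hξ : 0 < xCoord u + yCoord u)
    (hp : 0 ≤ p) : ∃ (c : ℂ) (ω : Circle), orderOf ω = 3 ∧ PreservesTiling (rotation c ω) ∧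
      rotationOnTangent c ω '' orbit x = orbit x := by
  obtain ⟨hx, τ, hτ, hper⟩ := hx
  obtain ⟨hbd, T, -, hT, hall⟩ := hx.exists_passages h hη hξ hp
  obtain ⟨s, hs, hst⟩ := exists_ge_eq hτ hper t (T 1)
  obtain ⟨N, hN, hcen, hNs⟩ := hall 1 s hs 0 (zero_mem _) (hst ▸ h.1)
  have hoff : offsetSeq (xCoord u) (-yCoord u) p N = p := by
    obtain ⟨-, h1, h2⟩ := hNs
    rw [← h2, ← hcen, ← h1, hst, h.2.1, h.2.2]
  obtain ⟨n, hn3, hn⟩ := exists_not_three_dvd (fun n => (hbd n).1) (fun n => (hbd n).2) hN hoff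
    hcen.symm
  set l := centreSeq (xCoord u) (-yCoord u) p n with hl
  have hf : IsTilingSymmetry (tilingMap (2 * n) l) :=
    isTilingSymmetry_rotation _ (centreSeq_mem _ _ _ _)
  set y : ℝ → UnitTangentBundle := fun t => tangentMap (tilingMap (2 * n) l).symm (x t) with hyd
  have hxy : x = fun t => tangentMap (tilingMap (2 * n) l) (y t) := by
    funext t
    rw [hyd, tangentMap_apply_symm]
  have hy : Passage y (T n) 0 u p := by
    have h1 := hT n
    rw [NthPassage, hn, ← hl] at h1
    have hl0 : l = l + (zeta : ℂ) ^ (2 * n) * 0 := by simp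
    rw [hl0, hxy] at h1
    exact passage_tilingMap_iff.1 h1
  obtain ⟨s₁, s₂, h12⟩ := hx.exists_eq (hf.symm.isTrajectory hx) h hy
    (show xCoord u ≠ 0 by linarith)
  have hord := orderOf_zeta_pow hn3
  have hne : (1 : ℂ) - (zeta : ℂ) ^ (2 * n) ≠ 0 := by
    intro h0
    have : zeta ^ (2 * n) = 1 := Circle.ext (by push_cast; exact (sub_eq_zero.1 h0).symm)
    rw [this, orderOf_one] at hord
    omega
  have hc : rotation (2 * l / (1 - (zeta : ℂ) ^ (2 * n))) (zeta ^ (2 * n)) 0 = 2 * l := by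
    simp only [rotation, Circle.coe_pow]
    field_simp
    ring
  refine ⟨2 * l / (1 - (zeta : ℂ) ^ (2 * n)), zeta ^ (2 * n), hord, ?_, ?_⟩
  · rw [rotation_eq_tilingMap hc]
    exact hf.preservesTiling
  · rw [rotationOnTangent_eq_tangentMap hc]
    refine image_orbit_eq hx hτ hper hf (s := s₁) (s' := s₂) ?_
    rw [h12, tangentMap_apply_symm]

/-! ### There is no symmetry of order six -/

theorem eq_zero_of_norm_le {w e : ℂ} (he : ‖e‖ = 1) (h1 : ‖w + e‖ ≤ 1) (h2 : ‖w - e‖ ≤ 1) :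
    w = 0 := by
  have h3 := parallelogram_law_with_norm ℝ w e
  rw [he] at h3
  have h4 : ‖w‖ * ‖w‖ ≤ 0 := by nlinarith [norm_nonneg (w + e), norm_nonneg (w - e)]
  have h5 : ‖w‖ = 0 := by nlinarith [norm_nonneg w]
  exact norm_eq_zero.1 h5

theorem norm_of_mem_hexagonVertices {v : ℂ} (hv : v ∈ hexagonVertices 0) : ‖v‖ = 1 := by
  rw [← pow_eq_one_iff_of_nonneg (norm_nonneg _) two_ne_zero, norm_sq_coord]
  simp only [hexagonVertices_zero, mem_insert_iff, mem_singleton_iff] at hv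
  rcases hv with rfl | rfl | rfl | rfl | rfl | rfl <;> simp

/-- A rotation that preserves the tiling maps the centre of a hexagon to the centre of a hexagon,
since the centre of a hexagon can be recovered from the hexagon, and a triangle has no such
centre. -/
theorem exists_rotation_zero_eq {c : ℂ} {ω : Circle} (h : PreservesTiling (rotation c ω)) :
    ∃ l ∈ eisensteinLattice, rotation c ω 0 = 2 * l := by
  have hmem : rotation c ω '' convexHull ℝ (hexagonVertices 0) ∈ tiles := by
    have h0 : convexHull ℝ (hexagonVertices 0) ∈ tiles := Or.inl ⟨0, zero_mem _, by simp⟩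
    exact h ▸ mem_image_of_mem (fun P => rotation c ω '' P) h0
  have key : ∀ w : ℂ, rotation c ω '' convexHull ℝ (hexagonVertices 0) ⊆ Metric.closedBall w 1 →
      rotation c ω 0 = w := by
    intro w hw
    have hpt : ∀ v ∈ hexagonVertices 0, ‖rotation c ω v - w‖ ≤ 1 := fun v hv => by
      rw [← mem_closedBall_iff_norm]
      exact hw (mem_image_of_mem _ (subset_convexHull ℝ _ hv))
    have h1 : (1 : ℂ) ∈ hexagonVertices 0 := by simp [hexagonVertices, v₀]
    have h2 : (-1 : ℂ) ∈ hexagonVertices 0 := by simp [hexagonVertices, v₀]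
    refine sub_eq_zero.1 (eq_zero_of_norm_le (Circle.norm_coe ω) ?_ ?_)
    · convert hpt _ h1 using 2
      simp only [rotation]; ring
    · convert hpt _ h2 using 2
      simp only [rotation]; ring
  rcases hmem with ⟨l, hl, hP⟩ | ⟨a, b, d, ⟨-, -, hab⟩, ⟨-, -, hbd⟩, ⟨-, -, hda⟩, hP⟩
  · refine ⟨l, hl, key _ ?_⟩
    rw [hP]
    refine convexHull_min (fun v hv => ?_) (convex_closedBall _ _)
    rw [mem_closedBall_iff_norm, norm_of_mem_hexagonVertices (mem_hexagonVertices_iff.1 hv)]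
  · have ha : rotation c ω 0 = a := by
      refine key _ ?_
      rw [hP]
      refine convexHull_min ?_ (convex_closedBall _ _)
      rintro _ (rfl | rfl | rfl)
      · simp
      · rw [Metric.mem_closedBall, dist_comm, hab]
      · rw [Metric.mem_closedBall, hda]
    have hb : rotation c ω 0 = b := by
      refine key _ ?_
      rw [hP]
      refine convexHull_min ?_ (convex_closedBall _ _)
      rintro _ (rfl | rfl | rfl)
      · rw [Metric.mem_closedBall, hab]
      · simp
      · rw [Metric.mem_closedBall, dist_comm, hbd]
    rw [← ha, ← hb, dist_self] at hab
    exact absurd hab (by norm_num)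

theorem eq_zeta_pow_of_orderOf {ω : Circle} (h : orderOf ω = 6) :
    (ω : ℂ) ^ 3 = -1 ∧ ∃ k : ℕ, ω = zeta ^ k := by
  have h6 : (ω : ℂ) ^ 6 = 1 := by
    have := pow_orderOf_eq_one ω
    rw [h] at this
    exact_mod_cast congrArg Subtype.val this
  have hne : ∀ k, 0 < k → k < 6 → (ω : ℂ) ^ k ≠ 1 := by
    intro k hk0 hk6 hk
    have h1 : ω ^ k = 1 := Circle.ext (by push_cast; exact hk)
    have := Nat.le_of_dvd hk0 (h ▸ orderOf_dvd_of_pow_eq_one h1)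
    omega
  have h3 : (ω : ℂ) ^ 3 = -1 := by
    have : ((ω : ℂ) ^ 3 - 1) * ((ω : ℂ) ^ 3 + 1) = 0 := by linear_combination h6
    rcases mul_eq_zero.1 this with h1 | h1
    · exact absurd (sub_eq_zero.1 h1) (hne 3 (by norm_num) (by norm_num))
    · exact eq_neg_of_add_eq_zero_left h1
  refine ⟨h3, ?_⟩
  have hz : (zeta : ℂ) ^ 2 = zeta - 1 := by
    rw [zeta_sq_eq]
    simp [pt]; ring
  have h4 : ((ω : ℂ) - zeta) * ((ω + 1) * (ω - 1 + zeta)) = 0 := by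
    linear_combination h3 - ((ω : ℂ) + 1) * hz
  rcases mul_eq_zero.1 h4 with h5 | h5
  · exact ⟨1, Circle.ext (by simpa using sub_eq_zero.1 h5)⟩
  · refine ⟨5, Circle.ext ?_⟩
    rcases mul_eq_zero.1 h5 with h6 | h6
    · refine absurd ?_ (hne 2 (by norm_num) (by norm_num))
      rw [eq_neg_of_add_eq_zero_left h6]; norm_num
    · push_cast
      rw [show 5 = 3 + 2 from rfl, pow_add, zeta_pow_three, hz]
      linear_combination h6

/-- There is no symmetry of order six of the path, since it would reverse the sign of the offset of
some passage. -/
theorem not_image_path_eq {x : ℝ → UnitTangentBundle} (hx : IsPeriodicTrajectory x) {t p : ℝ}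
    {u : ℂ} (h : Passage x t 0 u p) (hη : yCoord u ≤ 0) (hξ : 0 < xCoord u + yCoord u)
    (hp : 0 ≤ p) {c : ℂ} {ω : Circle} (hω : orderOf ω = 6)
    (hpres : PreservesTiling (rotation c ω)) : rotation c ω '' path x ≠ path x := by
  intro himg
  obtain ⟨hx, τ, hτ, hper⟩ := hx
  obtain ⟨hbd, T, hT0, hT, hall⟩ := hx.exists_passages h hη hξ hp
  obtain ⟨l, hl, hc⟩ := exists_rotation_zero_eq hpres
  obtain ⟨hω3, k, rfl⟩ := eq_zeta_pow_of_orderOf hω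
  rw [rotation_eq_tilingMap hc] at himg
  rw [Circle.coe_pow] at hω3
  set ε : ℂ := (zeta : ℂ) ^ k with hε
  have hu0 : u ≠ 0 := by
    rintro rfl
    simp at hξ
  have hε0 : ε ≠ 0 := pow_ne_zero _ (Circle.coe_ne_zero _)
  -- a short segment of the trajectory in the hexagon with centre zero
  have hev : ∀ᶠ s in 𝓝[>] t, x s = straight (x t) t s ∧ (straight (x t) t s).1 ∈ hexInt 0 := by
    refine ((hx.germ_right t).filter_mono (nhdsWithin_mono _ Ioi_subset_Ici_self)).and ?_
    have hcont : Continuous fun s => (straight (x t) t s).1 := by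
      simp only [straight]; fun_prop
    refine (hcont.tendsto t).mono_left nhdsWithin_le_nhds ((isOpen_hexInt 0).mem_nhds ?_)
    rw [straight_self]
    simpa using h.1
  obtain ⟨t₁, ht₁, hseg⟩ := (mem_nhdsGT_iff_exists_Ioc_subset).1 hev
  have hpos : ∀ s ∈ Ioc t t₁, (x s).1 = (x t).1 + (s - t) • u := fun s hs => by
    rw [(hseg hs).1, straight, h.2.1]
  -- the times at which the trajectory is in the image of the segment
  set S : Set ℝ := {r | ∃ s ∈ Ioc t t₁, (x r).1 = tilingMap k l (x s).1} with hS
  have hSunc : ¬S.Countable := by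
    intro hcount
    have h1 : ((fun s => tilingMap k l (x s).1) '' Ioc t t₁).Countable := by
      refine (hcount.image fun r => (x r).1).mono ?_
      rintro _ ⟨s, hs, rfl⟩
      have : tilingMap k l (x s).1 ∈ path x := himg ▸ mem_image_of_mem _ ⟨s, rfl⟩
      obtain ⟨r, hr⟩ := this
      exact ⟨r, ⟨s, hs, hr⟩, hr⟩
    have hinj : InjOn (fun s => tilingMap k l (x s).1) (Ioc t t₁) := by
      intro s hs s' hs' hss
      have h2 := (tilingMap k l).injective hss
      rw [hpos s hs, hpos s' hs', add_right_inj] at h2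
      have := smul_left_injective ℝ hu0 h2
      simpa using this
    have h3 : (Ioc t t₁).Countable := countable_of_injective_of_countable_image hinj h1
    have h4 := h3.measure_zero MeasureTheory.volume
    rw [Real.volume_Ioc, ENNReal.ofReal_eq_zero] at h4
    have : t < t₁ := ht₁
    linarith
  -- one of these times is an accumulation point of such times
  obtain ⟨r, hrS, hr⟩ : ∃ r ∈ S, 𝓝[S ∩ Ioi r] r ≠ ⊥ := by
    by_contra! hcon
    have hcount := countable_setOfPred_isolated_right_within (s := S)
    refine hSunc (hcount.mono fun r hr => ?_)
    rw [mem_ofPred_eq]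
    exact ⟨hr, hcon r hr⟩
  have : (𝓝[S ∩ Ioi r] r).NeBot := ⟨hr⟩
  have hev' : ∀ᶠ q in 𝓝[S ∩ Ioi r] r, x q = straight (x r) r q :=
    (hx.germ_right r).filter_mono
      (nhdsWithin_mono _ (inter_subset_right.trans Ioi_subset_Ici_self))
  obtain ⟨q, hq, hqS, hrq⟩ := (hev'.and self_mem_nhdsWithin).exists
  obtain ⟨s, hs, hrs⟩ := hrS
  obtain ⟨s', hs', hqs⟩ := hqS
  rw [mem_Ioi] at hrq
  -- the image of the segment is part of a passage through the hexagon with centre `2 * l`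
  have hin : (x r).1 ∈ hexInt (2 * l) := by
    rw [hrs, mem_hexInt_iff_sub, tilingMap_apply, add_sub_cancel_left,
      zeta_pow_mul_mem_hexInt_iff, (hseg hs).1]
    exact (hseg hs).2
  obtain ⟨r', hr', hrr⟩ := exists_ge_eq hτ hper r (T 0)
  obtain ⟨n, -, hcen, -, hdir, hoff⟩ := hall 0 r' hr' l hl (hrr ▸ hin)
  rw [hrr] at hdir hoff
  rw [← hcen] at hoff
  have hpar : ((q - r : ℝ) : ℂ) * (zeta : ℂ) ^ (2 * n) = ((s' - s : ℝ) : ℂ) * ε := by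
    have h1 : (x q).1 - (x r).1 = (q - r) • ((zeta : ℂ) ^ (2 * n) * u) := by
      rw [hq, straight, hdir]; simp
    rw [hqs, hrs, tilingMap_apply, tilingMap_apply, hpos s hs, hpos s' hs'] at h1
    simp only [Complex.real_smul] at h1
    refine mul_right_cancel₀ hu0 ?_
    push_cast at h1 ⊢
    linear_combination -h1
  -- the cubes of the two directions have opposite signs
  have hcube : (q - r) ^ 3 = (-(s' - s)) ^ 3 := by
    have h1 := congrArg (· ^ 3) hpar
    simp only [mul_pow, hω3] at h1
    rw [← pow_mul, mul_right_comm, pow_mul, mul_comm 2 3, pow_mul, zeta_pow_three] at h1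
    have h2 : (((q - r) ^ 3 : ℝ) : ℂ) = (((-(s' - s)) ^ 3 : ℝ) : ℂ) := by
      push_cast at h1 ⊢
      simp only [neg_one_sq, one_pow, mul_one] at h1
      rw [h1]; ring
    exact_mod_cast h2
  have hqr : q - r = -(s' - s) := (Odd.strictMono_pow (by decide : Odd 3)).injective hcube
  have hdir' : (zeta : ℂ) ^ (2 * n) = -ε := by
    have h1 : ((q - r : ℝ) : ℂ) ≠ 0 := by
      exact_mod_cast (sub_pos.2 hrq).ne'
    refine mul_left_cancel₀ h1 ?_
    rw [hpar, show s' - s = -(q - r) by rw [hqr]; ring]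
    push_cast; ring
  have hoff' : offset (-(ε * u)) (ε * (x s).1) = -p := by
    have h1 : offset (-(ε * u)) (ε * (x s).1) = -offset (ε * u) (ε * (x s).1) := by
      simp only [offset, map_neg]; ring
    rw [h1, hε, offset_zeta_pow_mul, hpos s hs, offset_add_smul, ← h.2.2]
    simp
  rw [hdir', hrs, tilingMap_apply, add_sub_cancel_left, neg_mul, hoff'] at hoff
  have := (hbd n).1
  linarith

/-! ### Reduction to a normalised passage -/

/-- There is a rotational symmetry of order three, but none of order six. -/
def ThreefoldNotSixfold (x : ℝ → UnitTangentBundle) : Prop :=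
  (∃ (c : ℂ) (ω : Circle), orderOf ω = 3 ∧ PreservesTiling (rotation c ω) ∧
      rotationOnTangent c ω '' orbit x = orbit x ∧ rotation c ω '' path x = path x) ∧
    ∀ (c : ℂ) (ω : Circle), orderOf ω = 6 → PreservesTiling (rotation c ω) →
      rotationOnTangent c ω '' orbit x ≠ orbit x ∧ rotation c ω '' path x ≠ path x

theorem PreservesTiling.comp {f g : ℂ → ℂ} (hf : PreservesTiling f) (hg : PreservesTiling g) :
    PreservesTiling (f ∘ g) := by
  have h : (fun P : Set ℂ => (f ∘ g) '' P) = (fun P => f '' P) ∘ fun P => g '' P := by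
    funext P
    exact image_comp f g P
  rw [PreservesTiling, h, image_comp, hg, hf]

/-- The statement for the image of `x` under a symmetry of the tiling implies that for `x`. The
isomorphism `κ` describes how the symmetry conjugates rotations. -/
theorem ThreefoldNotSixfold.of_symmetry {f : ℂ ≃ᵃⁱ[ℝ] ℂ} (hf : IsTilingSymmetry f)
    {κ : Circle ≃* Circle}
    (hκ : ∀ (ω : Circle) (z : ℂ),
      f.linearIsometryEquiv (ω * z) = κ ω * f.linearIsometryEquiv z)
    {x : ℝ → UnitTangentBundle} (h : ThreefoldNotSixfold fun t => tangentMap f (x t)) :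
    ThreefoldNotSixfold x := by
  have h1 : ∀ (c : ℂ) (ω : Circle) (z : ℂ),
      f (rotation c ω z) = rotation (f c) (κ ω) (f z) := by
    intro c ω z
    have h2 := apply_add_smul f c (ω * (z - c)) 1
    rw [one_smul, one_smul, hκ, linear_sub] at h2
    exact h2
  have h2 : ∀ (c : ℂ) (ω : Circle) (v : UnitTangentBundle),
      tangentMap f (rotationOnTangent c ω v) =
        rotationOnTangent (f c) (κ ω) (tangentMap f v) := by
    intro c ω v
    refine Prod.ext (h1 c ω v.1) (Circle.ext ?_)
    simp [rotationOnTangent, hκ]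
  set y : ℝ → UnitTangentBundle := fun t => tangentMap f (x t) with hy
  have ho : orbit y = tangentMap f '' orbit x := by
    rw [orbit, orbit, ← range_comp]; rfl
  have hp : path y = f '' path x := by
    rw [path, path, ← range_comp]; rfl
  have hinj : Function.Injective (tangentMap f) :=
    Function.LeftInverse.injective (tangentMap_symm_apply f)
  have ho' : ∀ c ω, rotationOnTangent (f c) (κ ω) '' orbit y = orbit y ↔
      rotationOnTangent c ω '' orbit x = orbit x := by
    intro c ω
    rw [ho, ← hinj.image_injective.eq_iff (a := rotationOnTangent c ω '' orbit x), ← image_comp,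
      ← image_comp]
    simp only [Function.comp_def, h2]
  have hp' : ∀ c ω, rotation (f c) (κ ω) '' path y = path y ↔
      rotation c ω '' path x = path x := by
    intro c ω
    rw [hp, ← f.injective.image_injective.eq_iff (a := rotation c ω '' path x), ← image_comp,
      ← image_comp]
    simp only [Function.comp_def, h1]
  have ht : ∀ c ω, PreservesTiling (rotation (f c) (κ ω)) ↔ PreservesTiling (rotation c ω) := by
    intro c ω
    constructor
    · intro h3
      have : rotation c ω = f.symm ∘ rotation (f c) (κ ω) ∘ f := by
        funext z
        simp [← h1]
      rw [this]
      exact hf.symm.preservesTiling.comp (h3.comp hf.preservesTiling)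
    · intro h3
      have : rotation (f c) (κ ω) = f ∘ rotation c ω ∘ f.symm := by
        funext z
        simp [h1]
      rw [this]
      exact hf.preservesTiling.comp (h3.comp hf.symm.preservesTiling)
  obtain ⟨⟨c, ω, h3, h4, h5, h6⟩, h7⟩ := h
  refine ⟨⟨f.symm c, κ.symm ω, ?_, ?_, ?_, ?_⟩, fun c ω hω hpres => ?_⟩
  · rw [MulEquiv.orderOf_eq, h3]
  · rw [← ht]; simpa using h4
  · rw [← ho']; simpa using h5
  · rw [← hp']; simpa using h6
  · obtain ⟨h8, h9⟩ := h7 (f c) (κ ω) (by rw [MulEquiv.orderOf_eq, hω]) ((ht c ω).2 hpres)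
    exact ⟨fun h => h8 ((ho' c ω).2 h), fun h => h9 ((hp' c ω).2 h)⟩

theorem IsPeriodicTrajectory.map {f : ℂ ≃ᵃⁱ[ℝ] ℂ} (hf : IsTilingSymmetry f)
    {x : ℝ → UnitTangentBundle} (hx : IsPeriodicTrajectory x) :
    IsPeriodicTrajectory fun t => tangentMap f (x t) :=
  let ⟨h, τ, hτ, hper⟩ := hx
  ⟨hf.isTrajectory h, τ, hτ, fun t => by simp only [hper t]⟩

/-- Rotating by a multiple of `π / 3` brings a direction into a given sector. -/
theorem exists_sector {u : ℂ} (hu : u ≠ 0) : ∃ k : ℕ, yCoord ((zeta : ℂ) ^ k * u) ≤ 0 ∧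
    0 < xCoord ((zeta : ℂ) ^ k * u) + yCoord ((zeta : ℂ) ^ k * u) := by
  obtain ⟨e2, e2'⟩ := coord_zeta_pow_two u
  have hne : ¬(xCoord u = 0 ∧ yCoord u = 0) := fun h =>
    hu (coord_ext (by simpa using h.1) (by simpa using h.2))
  -- the plane without the origin is the union of six half-open sectors
  have key : (yCoord u ≤ 0 ∧ 0 < xCoord u + yCoord u) ∨ (xCoord u + yCoord u ≤ 0 ∧ 0 < xCoord u) ∨
      (xCoord u ≤ 0 ∧ yCoord u < 0) ∨ (0 ≤ yCoord u ∧ xCoord u + yCoord u < 0) ∨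
      (0 ≤ xCoord u + yCoord u ∧ xCoord u < 0) ∨ (0 ≤ xCoord u ∧ 0 < yCoord u) := by
    by_contra! hcon
    obtain ⟨h1, h2, h3, h4, h5, h6⟩ := hcon
    apply hne
    rcases lt_trichotomy (xCoord u) 0 with h | h | h <;>
      rcases lt_trichotomy (yCoord u) 0 with h' | h' | h' <;>
      rcases lt_trichotomy (xCoord u + yCoord u) 0 with h'' | h'' | h'' <;>
      first
        | exact ⟨h, h'⟩
        | (exfalso; first
            | linarith
            | linarith [h1 (by linarith)]
            | linarith [h2 (by linarith)]
            | linarith [h3 (by linarith)]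
            | linarith [h4 (by linarith)]
            | linarith [h5 (by linarith)]
            | linarith [h6 (by linarith)])
  rcases key with ⟨h1, h2⟩ | ⟨h1, h2⟩ | ⟨h1, h2⟩ | ⟨h1, h2⟩ | ⟨h1, h2⟩ | ⟨h1, h2⟩
  · exact ⟨0, by simpa using h1, by simpa using h2⟩
  · exact ⟨1, by simpa using h1, by simpa using h2⟩
  · refine ⟨2, by rw [e2']; exact h1, by rw [e2, e2']; linarith⟩
  · refine ⟨3, ?_, ?_⟩ <;> simp only [zeta_pow_three, neg_one_mul, map_neg] <;> linarith
  · refine ⟨4, ?_, ?_⟩ <;>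
      simp only [zeta_pow_four, neg_mul, map_neg, xCoord_zeta_mul, yCoord_zeta_mul] <;> linarith
  · refine ⟨5, ?_, ?_⟩ <;> simp only [zeta_pow_five, neg_mul, map_neg, e2, e2'] <;> linarith

theorem ThreefoldNotSixfold.of_tilingMap {k : ℕ} {l : ℂ} (hl : l ∈ eisensteinLattice)
    {x : ℝ → UnitTangentBundle}
    (h : ThreefoldNotSixfold fun t => tangentMap (tilingMap k l) (x t)) :
    ThreefoldNotSixfold x :=
  of_symmetry (isTilingSymmetry_rotation k hl) (κ := MulEquiv.refl Circle) (fun ω z => by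
    change (tilingMap k l).linearIsometryEquiv _ = ω * (tilingMap k l).linearIsometryEquiv _
    rw [tilingMap_linear, tilingMap_linear]
    ring) h

theorem threefoldNotSixfold_of_passage {x : ℝ → UnitTangentBundle} (hx : IsPeriodicTrajectory x)
    {t p : ℝ} {u : ℂ} (h : Passage x t 0 u p) (hp : 0 ≤ p) : ThreefoldNotSixfold x := by
  obtain ⟨k, hη, hξ⟩ := exists_sector (u := u) (h.2.1 ▸ Circle.coe_ne_zero _)
  refine .of_tilingMap (k := k) (zero_mem _) ?_
  have hx' := hx.map (f := tilingMap k 0) (isTilingSymmetry_rotation k (zero_mem _))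
  have h' := (passage_tilingMap_iff (l := 0) (k := k)).2 h
  rw [mul_zero, add_zero] at h'
  obtain ⟨c, ω, h1, h2, h3⟩ := exists_threefold hx' h' hη hξ hp
  refine ⟨⟨c, ω, h1, h2, h3, image_path_of_image_orbit h3⟩, fun c ω hω hpres => ?_⟩
  have h4 := not_image_path_eq hx' h' hη hξ hp hω hpres
  exact ⟨fun h5 => h4 (image_path_of_image_orbit h5), h4⟩

/-- The reflection in the real axis changes the sign of the offsets. -/
theorem threefoldNotSixfold_of_mem_hexInt {x : ℝ → UnitTangentBundle}
    (hx : IsPeriodicTrajectory x) {t : ℝ} (h : (x t).1 ∈ hexInt 0) : ThreefoldNotSixfold x := by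
  have hpass : ∀ y : ℝ → UnitTangentBundle, (y t).1 ∈ hexInt 0 →
      Passage y t 0 (y t).2 (offset (y t).2 (y t).1) := fun y hy => by
    simpa [Passage] using hy
  rcases le_total 0 (offset (x t).2 (x t).1) with h0 | h0
  · exact threefoldNotSixfold_of_passage hx (hpass x h) h0
  set f := isometryOf Complex.conjLIE (2 * 0) with hf
  have hlin : ∀ z, f.linearIsometryEquiv z = (starRingEnd ℂ) z := fun z => by
    rw [hf, isometryOf_linear]; rfl
  have happ : ∀ z, f z = (starRingEnd ℂ) z := fun z => by
    rw [hf, isometryOf_apply, mul_zero, zero_add]; rfl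
  refine .of_symmetry isTilingSymmetry_conj (κ := MulEquiv.inv Circle) (fun ω z => ?_) ?_
  · rw [← hf, hlin, hlin, map_mul, MulEquiv.inv_apply, Circle.coe_inv_eq_conj]
  · refine threefoldNotSixfold_of_passage (hx.map isTilingSymmetry_conj) (hpass _ ?_) ?_
    · rw [tangentMap_fst, ← hf, happ]
      rw [mem_hexInt_zero] at h ⊢
      rw [(coord_conj _).1, (coord_conj _).2]
      refine ⟨⟨?_, ?_⟩, ⟨?_, ?_⟩, ⟨?_, ?_⟩⟩ <;> linarith
    · rw [tangentMap_fst, coe_tangentMap_snd, ← hf, happ, hlin]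
      simp only [offset, (coord_conj _).1, (coord_conj _).2] at h0 ⊢
      linarith

/-- A periodic trajectory leaves the interiors of the tiles, since it is not straight. -/
theorem IsPeriodicTrajectory.exists_not_inTile {x : ℝ → UnitTangentBundle}
    (hx : IsPeriodicTrajectory x) : ∃ t, ¬InTile (x t).1 := by
  by_contra! hcon
  obtain ⟨hx, τ, hτ, hper⟩ := hx
  obtain ⟨h1, -⟩ := hx.left_limit (t := 0) (s := 0 + τ) (by linarith)
    (hx.run_of_inTile fun s _ _ => hcon s)
  rw [hper 0, left_eq_add, smul_eq_zero] at h1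
  rcases h1 with h1 | h1
  · linarith
  · exact Circle.coe_ne_zero _ h1

/-- At one side of an edge there is a hexagon, and a trajectory crosses the edge. -/
theorem IsTrajectory.exists_mem_hexInt_of_edge {y : ℝ → UnitTangentBundle} (hy : IsTrajectory y)
    {t : ℝ} (h1 : xCoord (y t).1 = 1) (h2 : -1 < yCoord (y t).1) (h3 : yCoord (y t).1 < 0) :
    ∃ s, (y s).1 ∈ hexInt 0 := by
  have he : IsEdge (pt (1 : ℤ) (0 : ℤ)) (pt (1 : ℤ) (-1 : ℤ)) :=
    isEdge_pt (by decide) (by decide) (by norm_num)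
  have hseg : ∀ z : ℂ, xCoord z = 1 → -1 < yCoord z → yCoord z < 0 →
      z ∈ openSegment ℝ (pt (1 : ℤ) (0 : ℤ)) (pt (1 : ℤ) (-1 : ℤ)) := fun z k1 k2 k3 =>
    mem_openSegment_of_coord (-yCoord z) (by linarith) (by linarith) (by simp [k1]) (by simp)
  have href : ∀ d : ℂ, xCoord (refract (pt (1 : ℤ) (-1 : ℤ) - pt (1 : ℤ) (0 : ℤ)) d) = xCoord d ∧
      yCoord (refract (pt (1 : ℤ) (-1 : ℤ) - pt (1 : ℤ) (0 : ℤ)) d) = -xCoord d - yCoord d := by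
    intro d
    obtain ⟨k1, k2⟩ := refract_coord (e := pt (1 : ℤ) (-1 : ℤ) - pt (1 : ℤ) (0 : ℤ)) d (by simp)
    refine ⟨by simpa using k1, ?_⟩
    rw [k2]; simp; ring
  have hcont : ∀ d : Circle, Continuous fun s => (straight ((y t).1, d) t s).1 := fun d => by
    simp only [straight]; fun_prop
  -- near the crossing, the two other pairs of edges of the hexagon are far away
  have hnear : ∀ d : Circle, ∀ᶠ s in 𝓝 t,
      0 < xCoord (straight ((y t).1, d) t s).1 ∧ -1 < yCoord (straight ((y t).1, d) t s).1 ∧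
        yCoord (straight ((y t).1, d) t s).1 < 0 ∧
        xCoord (straight ((y t).1, d) t s).1 + yCoord (straight ((y t).1, d) t s).1 < 1 := by
    intro d
    have hx : Continuous fun s => xCoord (straight ((y t).1, d) t s).1 :=
      continuous_xCoord.comp (hcont d)
    have hy : Continuous fun s => yCoord (straight ((y t).1, d) t s).1 :=
      continuous_yCoord.comp (hcont d)
    have hxy : Continuous fun s => xCoord (straight ((y t).1, d) t s).1 +
        yCoord (straight ((y t).1, d) t s).1 := hx.add hy
    refine ((hx.tendsto t).eventually (lt_mem_nhds ?_)).and
      (((hy.tendsto t).eventually (lt_mem_nhds ?_)).and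
      (((hy.tendsto t).eventually (gt_mem_nhds ?_)).and
      ((hxy.tendsto t).eventually (gt_mem_nhds ?_)))) <;>
    rw [straight_self] <;> simp only [h1] <;> linarith
  obtain ⟨d, hd, -, hd'⟩ := hy.germ_left t
  have hvd := hd' _ _ he (hseg _ h1 h2 h3)
  have hright := (hy.germ_right t).filter_mono (nhdsWithin_mono _ Ioi_subset_Ici_self)
  rcases lt_trichotomy (xCoord (y t).2) 0 with hv | hv | hv
  · obtain ⟨s, ⟨hs, k1, k2, k3, k4⟩, hts⟩ :=
      ((hright.and ((hnear (y t).2).filter_mono nhdsWithin_le_nhds)).and self_mem_nhdsWithin).exists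
    have k5 : xCoord (straight (y t) t s).1 < 1 := by
      simp only [straight, map_add, map_smul, smul_eq_mul, h1]
      nlinarith
    refine ⟨s, ?_⟩
    rw [hs, mem_hexInt_zero]
    exact ⟨⟨by linarith, k5⟩, ⟨k2, by linarith⟩, by linarith, k4⟩
  · -- a motion along the edge would be reversed at once
    exfalso
    obtain ⟨s, hts, hs⟩ := (mem_nhdsGT_iff_exists_Ioc_subset).1
      (hright.and ((hnear (y t).2).filter_mono nhdsWithin_le_nhds))
    rw [mem_Ioi] at hts
    have hst : ∀ r ∈ Ico t s, y r = straight (y t) t r := by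
      intro r hr
      rcases hr.1.eq_or_lt with rfl | h
      · rw [straight_self]
      · exact (hs ⟨h, hr.2.le⟩).1
    obtain ⟨-, -, k1⟩ := hy.left_limit hts hst
    obtain ⟨k2, k3, k4, k5, -⟩ := hs ⟨hts, le_rfl⟩
    have k6 := k1 _ _ he (hseg _ (by
      rw [k2]
      simp only [straight, map_add, map_smul, smul_eq_mul, h1, hv, mul_zero, add_zero])
      (by rw [k2]; exact k4) (by rw [k2]; exact k5))
    rw [k2] at k6
    have k7 := congrArg yCoord k6
    rw [(href _).2, hv] at k7
    have k8 : yCoord (y t).2 = 0 := by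
      simp only [straight] at k7
      linarith
    exact Circle.coe_ne_zero (y t).2 (coord_ext (by simpa using hv) (by simpa using k8))
  · obtain ⟨s, ⟨hs, k1, k2, k3, k4⟩, hts⟩ :=
      ((hd.and ((hnear d).filter_mono nhdsWithin_le_nhds)).and self_mem_nhdsWithin).exists
    have hvd' : 0 < xCoord d := by
      rw [hvd, (href _).1] at hv
      exact hv
    have k5 : xCoord (straight ((y t).1, d) t s).1 < 1 := by
      simp only [straight, map_add, map_smul, smul_eq_mul, h1]
      nlinarith
    refine ⟨s, ?_⟩
    rw [hs, mem_hexInt_zero]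
    exact ⟨⟨by linarith, k5⟩, ⟨k2, by linarith⟩, by linarith, k4⟩

end Trihexagonal

end


theorem corollary5p6 (x : ℝ → Trihexagonal.UnitTangentBundle)
    (hx : Trihexagonal.IsPeriodicTrajectory x) :
    (∃ (c : ℂ) (ω : Circle), orderOf ω = 3 ∧
        Trihexagonal.PreservesTiling (Trihexagonal.rotation c ω) ∧
        Trihexagonal.rotationOnTangent c ω '' Trihexagonal.orbit x = Trihexagonal.orbit x ∧
        Trihexagonal.rotation c ω '' Trihexagonal.path x = Trihexagonal.path x) ∧
      ∀ (c : ℂ) (ω : Circle), orderOf ω = 6 →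
        Trihexagonal.PreservesTiling (Trihexagonal.rotation c ω) →
        Trihexagonal.rotationOnTangent c ω '' Trihexagonal.orbit x ≠ Trihexagonal.orbit x ∧
        Trihexagonal.rotation c ω '' Trihexagonal.path x ≠ Trihexagonal.path x := by
  obtain ⟨t, ht⟩ := hx.exists_not_inTile
  obtain ⟨k, l, hl, h⟩ := Trihexagonal.cover (hx.1.notMem_vertices t)
  have hf := Trihexagonal.isTilingSymmetry_rotation k hl
  refine Trihexagonal.ThreefoldNotSixfold.of_tilingMap (k := k) hl ?_
  have hx' := hx.map hf
  obtain ⟨s, hs⟩ : ∃ s, (Trihexagonal.tangentMap (Trihexagonal.tilingMap k l) (x s)).1 ∈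
      Trihexagonal.hexInt 0 := by
    rcases h with h | h | ⟨h1, h2, h3⟩
    · exact ⟨t, h⟩
    · exact absurd (.of_symmetry hf (Trihexagonal.inTile_of_mem_upperTriangle h)) ht
    · exact hx'.1.exists_mem_hexInt_of_edge h1 h2 h3
  exact Trihexagonal.threefoldNotSixfold_of_mem_hexInt hx' hs
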